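/- Let $D=\{z\in\mathbb R^2 : |z|\le 1\}$ be the closed unit disk with the standard symplectic form $\omega=dx\wedge dy$. Let $G=\mathrm{Symp}(D,\omega)$ be the group of diffeomorphisms $g$ of $D$ (smooth up to the boundary) with $g^*\omega=\omega$, let $G_{\mathrm{rel}}=\{g\in G : g|_{\partial D}=\mathrm{id}\}$, and let $G_\partial=\mathrm{Diff}^+(\partial D)=\mathrm{Diff}^+(S^1)$ be the group of orientation-preserving smooth diffeomorphisms of the circle. Let $H$ be the universal covering group of $G_\partial$, i.e. the group of increasing smooth diffeomorphisms $F$ of $\mathbb R$ with $F(t+2\pi)=F(t)+2\pi$, projecting to $G_\partial$ by $e^{it}\mapsto e^{iF(t)}$. All groups of maps are multiplied by composition, $(gh)(z)=g(h(z))$. Then: 1. Inclusion and restriction to the boundary give a group extension $1\to G_{\mathrm{rel}}\to G\to G_\partial\to 1$, and $n\mapsto (t\mapsto t+2\pi n)$ together with the projection gives a central extension $0\to\mathbb Z\to H\to G_\partial\to 1$. 2. For $h\in G_{\mathrm{rel}}$ the number $\mathrm{Cal}(h)=-\int_D\eta\wedge h^*\eta$ does not depend on the choice of the smooth $1$-form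 $\eta$ on $D$ with $d\eta=\omega$, and the Calabi invariant $\mathrm{Cal}:G_{\mathrm{rel}}\to\mathbb R$ is a $G$-invariant homomorphism, i.e. $\mathrm{Cal}\in\mathrm{Hom}(G_{\mathrm{rel}},\mathbb R)^G$. 3. Let $0\to\mathbb R\to H_{\mathbb R}\to G_\partial\to 1$ be the central extension induced from $H$ by $\mathbb Z\hookrightarrow\mathbb R$, where $H_{\mathbb R}=(H\times\mathbb R)/\!\sim$ with $(n\cdot F,a)\sim(F,n+a)$ for $n\in\mathbb Z$. Let $e(H_{\mathbb R})\in H^2(G_\partial;\mathbb R)$ be its extension class, represented by the cocycle $\chi(x,y)=s(x)s(y)s(xy)^{-1}$ for any set-theoretic section $s$ of $H_{\mathbb R}\to G_\partial$; cohomology is that of discrete groups with trivial action on $\mathbb R$. Let $d_2:\mathrm{Hom}(G_{\mathrm{rel}},\mathbb R)^G\cong E_2^{0,1}\to E_2^{2,0}\cong H^2(G_\partial;\mathbb R)$ be the transgression, that is, the differential induced by the group coboundary $\delta$ in the Lyndon–Hochschild–Serre spectral sequence of $1\to G_{\mathrm{rel}}\to G\to G_\partial\to 1$ (the connecting map of the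 five-term exact sequence), where $(\delta c)(g,h)=c(h)-c(gh)+c(g)$ on $1$-cochains. Then $$\pi^2\, e(H_{\mathbb R})=-d_2\,\mathrm{Cal}\quad\text{in } H^2(G_\partial;\mathbb R).$$ -/

import Mathlib

open scoped ContDiff Manifold
open MeasureTheory

universe u

noncomputable section

/-! ### Group extensions: push-out along a homomorphism, and the extension class -/

namespace GroupExtension

/-- The subgroup `{(i(n), f(n)⁻¹)}` of `E × A`. Its cosets are the classes of the equivalence
relation generated by `(i(n) γ, a) ∼ (γ, f(n) a)`, when `i(N)` is central in `E`. -/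
def pushoutKernel {N E Q A : Type*} [Group N] [Group E] [Group Q] [CommGroup A]
    (S : GroupExtension N E Q) (f : N →* A) : Subgroup (E × A) :=
  (S.inl.prod f⁻¹).range

theorem pushoutKernel_normal {N E Q A : Type*} [Group N] [Group E] [Group Q] [CommGroup A]
    (S : GroupExtension N E Q) (hS : S.inl.range ≤ Subgroup.center E) (f : N →* A) :
    (S.pushoutKernel f).Normal := by
  constructor
  rintro _ ⟨n, rfl⟩ ⟨e, a⟩
  refine ⟨n, ?_⟩
  have h := Subgroup.mem_center_iff.1 (hS ⟨n, rfl⟩) e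
  ext
  · simp [h]
  · simp

/-- The group `E_A = (E × A) / ∼` with `(i(n) γ, a) ∼ (γ, f(n) a)`. -/
abbrev PushoutGroup {N E Q A : Type*} [Group N] [Group E] [Group Q] [CommGroup A]
    (S : GroupExtension N E Q) (f : N →* A) : Type _ :=
  (E × A) ⧸ S.pushoutKernel f

/-- The central extension `1 → A → E_A → Q → 1` induced from a central extension
`1 → N → E → Q → 1` and a homomorphism `f : N → A`. The first map is `a ↦ [(1, a)]`, the second
one is `[(e, a)] ↦ p(e)`. -/
def pushout {N E Q A : Type*} [Group N] [Group E] [Group Q] [CommGroup A]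
    (S : GroupExtension N E Q) (hS : S.inl.range ≤ Subgroup.center E) (f : N →* A) :
    letI := S.pushoutKernel_normal hS f
    GroupExtension A (S.PushoutGroup f) Q :=
  letI := S.pushoutKernel_normal hS f
  { inl := (QuotientGroup.mk' (S.pushoutKernel f)).comp (MonoidHom.inr E A)
    rightHom := QuotientGroup.lift (S.pushoutKernel f) (S.rightHom.comp (MonoidHom.fst E A)) (by
      rintro _ ⟨n, rfl⟩
      simp)
    inl_injective := by
      rw [injective_iff_map_eq_one]
      intro a ha
      obtain ⟨n, hn⟩ := (QuotientGroup.eq_one_iff _).1 ha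
      have h1 : S.inl n = 1 := congrArg Prod.fst hn
      have h2 : (f n)⁻¹ = a := congrArg Prod.snd hn
      have h3 : n = 1 := S.inl_injective (by rw [h1, map_one])
      rw [← h2, h3, map_one, inv_one]
    range_inl_eq_ker_rightHom := by
      ext x
      constructor
      · rintro ⟨a, rfl⟩
        change S.rightHom 1 = 1
        exact map_one _
      · induction x using QuotientGroup.induction_on with
        | H x =>
          obtain ⟨e, a⟩ := x
          intro h
          have h' : e ∈ S.rightHom.ker := h
          rw [← S.range_inl_eq_ker_rightHom] at h'
          obtain ⟨n, rfl⟩ := h'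
          refine ⟨f n * a, QuotientGroup.eq.2 ⟨n, ?_⟩⟩
          ext
          · simp
          · simp [mul_comm]
    rightHom_surjective := by
      intro q
      obtain ⟨e, rfl⟩ := S.rightHom_surjective q
      exact ⟨QuotientGroup.mk (e, 1), rfl⟩ }

theorem range_inl_pushout_le_center {N E Q A : Type*} [Group N] [Group E] [Group Q] [CommGroup A]
    (S : GroupExtension N E Q) (hS : S.inl.range ≤ Subgroup.center E) (f : N →* A) :
    letI := S.pushoutKernel_normal hS f
    (S.pushout hS f).inl.range ≤ Subgroup.center (S.PushoutGroup f) := by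
  let _ := S.pushoutKernel_normal hS f
  rintro _ ⟨a, rfl⟩
  rw [Subgroup.mem_center_iff]
  intro x
  induction x using QuotientGroup.induction_on with
  | H x =>
    obtain ⟨e, b⟩ := x
    change QuotientGroup.mk ((e, b) * (1, a)) = QuotientGroup.mk ((1, a) * (e, b))
    congr 1
    ext <;> simp [mul_comm]

/-- A set-theoretic section of the projection `E → Q`. -/
def sec {N E Q : Type*} [Group N] [Group E] [Group Q] (S : GroupExtension N E Q) : Q → E :=
  Function.surjInv S.rightHom_surjective

@[simp]
theorem rightHom_sec {N E Q : Type*} [Group N] [Group E] [Group Q] (S : GroupExtension N E Q)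
    (q : Q) : S.rightHom (S.sec q) = q :=
  Function.surjInv_eq _ q

theorem exists_inl_eq {N E Q : Type*} [Group N] [Group E] [Group Q] (S : GroupExtension N E Q)
    {e : E} (he : S.rightHom e = 1) : ∃ n, S.inl n = e := by
  have h : e ∈ S.rightHom.ker := he
  rwa [← S.range_inl_eq_ker_rightHom] at h

theorem exists_inl_eq_sec {V : Type u} {E Q : Type*} [AddCommGroup V] [Group E] [Group Q]
    (S : GroupExtension (Multiplicative V) E Q) (x y : Q) :
    ∃ v : V, S.inl (Multiplicative.ofAdd v) = S.sec x * S.sec y * (S.sec (x * y))⁻¹ :=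
  S.exists_inl_eq (by simp)

/-- The factor set `χ(x, y) = s(x) s(y) s(xy)⁻¹` of an extension of `Q` by `V`. -/
def factorSet {V : Type u} {E Q : Type*} [AddCommGroup V] [Group E] [Group Q]
    (S : GroupExtension (Multiplicative V) E Q) (x : Q × Q) : V :=
  (S.exists_inl_eq_sec x.1 x.2).choose

theorem inl_factorSet {V : Type u} {E Q : Type*} [AddCommGroup V] [Group E] [Group Q]
    (S : GroupExtension (Multiplicative V) E Q) (x y : Q) :
    S.inl (Multiplicative.ofAdd (S.factorSet (x, y))) =
      S.sec x * S.sec y * (S.sec (x * y))⁻¹ :=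
  (S.exists_inl_eq_sec x y).choose_spec

theorem factorSet_mem {V Q : Type u} {E : Type*} (k : Type u) [CommRing k] [AddCommGroup V]
    [Module k V] [Group E] [Group Q] (S : GroupExtension (Multiplicative V) E Q)
    (hS : S.inl.range ≤ Subgroup.center E) :
    S.factorSet ∈ groupCohomology.cocycles₂ (Rep.trivial k Q V) := by
  rw [groupCohomology.mem_cocycles₂_iff]
  intro x y z
  change S.factorSet (x * y, z) + S.factorSet (x, y) =
    S.factorSet (y, z) + S.factorSet (x, y * z)
  apply Multiplicative.ofAdd.injective
  apply S.inl_injective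
  have hc := Subgroup.mem_center_iff.1
    (hS ⟨Multiplicative.ofAdd (S.factorSet (y, z)), rfl⟩) (S.sec x)
  have hc' := Subgroup.mem_center_iff.1
    (hS ⟨Multiplicative.ofAdd (S.factorSet (x, y)), rfl⟩) (S.inl (Multiplicative.ofAdd
      (S.factorSet (x * y, z))))
  rw [ofAdd_add, ofAdd_add, map_mul, map_mul, hc']
  have e1 : S.inl (Multiplicative.ofAdd (S.factorSet (x, y))) *
      S.inl (Multiplicative.ofAdd (S.factorSet (x * y, z))) =
      S.sec x * S.sec y * S.sec z * (S.sec (x * y * z))⁻¹ := by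
    rw [inl_factorSet, inl_factorSet]; group
  have e2 : S.inl (Multiplicative.ofAdd (S.factorSet (y, z))) *
      S.inl (Multiplicative.ofAdd (S.factorSet (x, y * z))) =
      S.sec x * S.sec y * S.sec z * (S.sec (x * y * z))⁻¹ := by
    rw [inl_factorSet S x (y * z), ← mul_assoc, ← mul_assoc, ← hc, inl_factorSet, mul_assoc x y z]
    group
  rw [e1, e2]

/-- The extension class in `H²(Q; V)` (trivial action) of a central extension
`0 → V → E → Q → 1`: the class of `χ(x, y) = s(x) s(y) s(xy)⁻¹`. -/
def extensionClass {V Q : Type u} {E : Type*} (k : Type u) [CommRing k] [AddCommGroup V]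
    [Module k V] [Group E] [Group Q] (S : GroupExtension (Multiplicative V) E Q)
    (hS : S.inl.range ≤ Subgroup.center E) : groupCohomology.H2 (Rep.trivial k Q V) :=
  groupCohomology.H2π (Rep.trivial k Q V) ⟨S.factorSet, S.factorSet_mem k hS⟩

/-- The extension class with coefficients in `V` along `f : N → V` of a central extension
`1 → N → E → Q → 1`: the extension class of the induced extension `0 → V → E_V → Q → 1`. -/
def extensionClassAlong {V Q : Type u} {N E : Type*} (k : Type u) [CommRing k] [AddCommGroup V]
    [Module k V] [Group N] [Group E] [Group Q] (S : GroupExtension N E Q)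
    (hS : S.inl.range ≤ Subgroup.center E) (f : N →* Multiplicative V) :
    groupCohomology.H2 (Rep.trivial k Q V) :=
  letI := S.pushoutKernel_normal hS f
  extensionClass k (S.pushout hS f) (S.range_inl_pushout_le_center hS f)

end GroupExtension

/-! ### The Lyndon–Hochschild–Serre spectral sequence -/

namespace LHS

/-- `Cⁿ(G; A)`, all functions `Gⁿ → A`. -/
abbrev Cochain {k G : Type u} [CommRing k] [Group G] (A : Rep.{u} k G) (n : ℕ) : Type u :=
  (Fin n → G) → A

/-- The coboundary `δ : Cⁿ(G; A) → Cⁿ⁺¹(G; A)`. -/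
def δ {k G : Type u} [CommRing k] [Group G] (A : Rep.{u} k G) (n : ℕ) :
    Cochain A n →ₗ[k] Cochain A (n + 1) :=
  (inhomogeneousCochains.d A n).hom

theorem δ_δ {k G : Type u} [CommRing k] [Group G] (A : Rep.{u} k G) (n : ℕ) (c : Cochain A n) :
    δ A (n + 1) (δ A n c) = 0 := by
  have h := groupCohomology.inhomogeneousCochains.d_comp_d (A := A) (n := n)
  have h' := congrArg (fun f => f.hom c) h
  simpa [δ] using h'

open Classical in
/-- The filtration `C_pⁿ` of the normalized cochains: those `c` with `c(g₁, …, gₙ) = 0` whenever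
at least `n - p + 1` of the arguments belong to `N`. In particular `C_pⁿ` is everything for
`p ≤ 0`, and it is `0` for `n < p`. -/
def filtration {k G : Type u} [CommRing k] [Group G] (N : Subgroup G) (A : Rep.{u} k G)
    (p : ℤ) (n : ℕ) : Submodule k (Cochain A n) where
  carrier := {c | (∀ g : Fin n → G, (∃ i, g i = 1) → c g = 0) ∧
    ∀ g : Fin n → G, (n : ℤ) - p + 1 ≤ (Finset.univ.filter fun i => g i ∈ N).card → c g = 0}
  add_mem' := fun {a b} ha hb =>
    ⟨fun g hg => by simp [ha.1 g hg, hb.1 g hg], fun g hg => by simp [ha.2 g hg, hb.2 g hg]⟩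
  zero_mem' := ⟨fun _ _ => rfl, fun _ _ => rfl⟩
  smul_mem' := fun t a ha =>
    ⟨fun g hg => by simp [ha.1 g hg], fun g hg => by simp [ha.2 g hg]⟩

/-- `Z_r^{p,q} = {c ∈ C_p^{p+q} | δc ∈ C_{p+r}^{p+q+1}}`, indexed by `p` and the total degree
`n = p + q`. -/
def Z {k G : Type u} [CommRing k] [Group G] (N : Subgroup G) (A : Rep.{u} k G)
    (r p : ℤ) (n : ℕ) : Submodule k (Cochain A n) :=
  filtration N A p n ⊓ (filtration N A (p + r) (n + 1)).comap (δ A n)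

/-- `δ Z_r^{p,n-1}`, in total degree `n`; it is `0` for `n = 0`. -/
def δZ {k G : Type u} [CommRing k] [Group G] (N : Subgroup G) (A : Rep.{u} k G)
    (r p : ℤ) : (n : ℕ) → Submodule k (Cochain A n)
  | 0 => ⊥
  | n + 1 => (Z N A r p n).map (δ A n)

/-- The denominator `Z_{r-1}^{p+1,q-1} + δ Z_{r-1}^{p+1-r,q+r-2}`, as a submodule of
`Z_r^{p,q}`. -/
def B {k G : Type u} [CommRing k] [Group G] (N : Subgroup G) (A : Rep.{u} k G)
    (r p : ℤ) (n : ℕ) : Submodule k (Z N A r p n) :=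
  (Z N A (r - 1) (p + 1) n ⊔ δZ N A (r - 1) (p + 1 - r) n).submoduleOf (Z N A r p n)

/-- The term `E_r^{p,q} = Z_r^{p,q} / (Z_{r-1}^{p+1,q-1} + δ Z_{r-1}^{p+1-r,q+r-2})` of the
Lyndon–Hochschild–Serre spectral sequence, indexed by `p` and the total degree `n = p + q`. -/
abbrev E {k G : Type u} [CommRing k] [Group G] (N : Subgroup G) (A : Rep.{u} k G)
    (r p : ℤ) (n : ℕ) : Type u :=
  Z N A r p n ⧸ B N A r p n

/-- `δ` as a map `Z_r^{p,q} → Z_r^{p+r,q-r+1}`. -/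
def δZ_map {k G : Type u} [CommRing k] [Group G] (N : Subgroup G) (A : Rep.{u} k G)
    (r p : ℤ) (n : ℕ) : Z N A r p n →ₗ[k] Z N A r (p + r) (n + 1) :=
  (δ A n).restrict fun c hc => ⟨hc.2, by
    rw [SetLike.mem_coe, Submodule.mem_comap, δ_δ]
    exact Submodule.zero_mem _⟩

/-- The differential `d_r : E_r^{p,q} → E_r^{p+r,q-r+1}` induced by `δ`. -/
def d {k G : Type u} [CommRing k] [Group G] (N : Subgroup G) (A : Rep.{u} k G)
    (r p : ℤ) (n : ℕ) : E N A r p n →ₗ[k] E N A r (p + r) (n + 1) :=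
  Submodule.mapQ _ _ (δZ_map N A r p n) (by
    rintro ⟨c, hc⟩ h
    obtain ⟨a, ha, b, hb, hab⟩ := Submodule.mem_sup.1 (Submodule.mem_comap.1 h)
    apply Submodule.mem_comap.2
    apply Submodule.mem_comap.2
    apply Submodule.mem_sup_right
    have hb0 : δ A n b = 0 := by
      cases n with
      | zero => rw [(Submodule.mem_bot k).1 hb, map_zero]
      | succ m => obtain ⟨b', -, rfl⟩ := hb; exact δ_δ A m b'
    refine ⟨a, by rwa [show p + r + 1 - r = p + 1 by ring], ?_⟩
    change δ A n a = δ A n c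
    have hab' : a + b = c := hab
    rw [← hab', map_add, hb0, add_zero])

theorem mem_filtration_self {k G : Type u} [CommRing k] [Group G] {N : Subgroup G}
    {A : Rep.{u} k G} {n : ℕ} {c : Cochain A n} :
    c ∈ filtration N A n n ↔ ∀ g : Fin n → G, (∃ i, g i ∈ N) → c g = 0 := by
  classical
  constructor
  · rintro ⟨-, h⟩ g ⟨i, hi⟩
    apply h
    have : 0 < (Finset.univ.filter fun i => g i ∈ N).card :=
      Finset.card_pos.2 ⟨i, by simpa using hi⟩
    convert (show (n : ℤ) - n + 1 ≤ (Finset.univ.filter fun i => g i ∈ N).card by lia)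
  · refine fun h => ⟨fun g ⟨i, hi⟩ => h g ⟨i, hi ▸ N.one_mem⟩, fun g hg => h g ?_⟩
    have : 0 < (Finset.univ.filter fun i => g i ∈ N).card := by
      have h1 : (n : ℤ) - n + 1 ≤ (Finset.univ.filter fun i => g i ∈ N).card := by convert hg
      lia
    obtain ⟨i, hi⟩ := Finset.card_pos.1 this
    exact ⟨i, by simpa using hi⟩

theorem mem_filtration_zero {k G : Type u} [CommRing k] [Group G] {N : Subgroup G}
    {A : Rep.{u} k G} {n : ℕ} {c : Cochain A n} :
    c ∈ filtration N A 0 n ↔ ∀ g : Fin n → G, (∃ i, g i = 1) → c g = 0 := by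
  classical
  refine ⟨fun h => h.1, fun h => ⟨h, fun g hg => ?_⟩⟩
  have h1 : (n : ℤ) - 0 + 1 ≤ (Finset.univ.filter fun i => g i ∈ N).card := by convert hg
  have h2 := Finset.card_le_univ (Finset.univ.filter fun i => g i ∈ N)
  rw [Fintype.card_fin] at h2
  lia

end LHS

/-! ### The transgression `Hom(N, V)^G ≅ E_2^{0,1} → E_2^{2,0} → H²(Q; V)` -/

namespace GroupExtension

/-- `Hom(N, V)^G`: the homomorphisms `f : N → V` with `f(g n g⁻¹) = f(n)` for `g ∈ G`. -/
def invariantHom {N G Q : Type*} (k : Type*) [CommRing k] [Group N] [Group G] [Group Q]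
    (S : GroupExtension N G Q) (V : Type*) [AddCommGroup V] [Module k V] :
    Submodule k (N → V) where
  carrier := {f | (∀ n m, f (n * m) = f n + f m) ∧ ∀ g n, f (S.conjAct g n) = f n}
  add_mem' := fun {a b} ha hb =>
    ⟨fun n m => by simp [ha.1, hb.1, add_add_add_comm], fun g n => by simp [ha.2, hb.2]⟩
  zero_mem' := ⟨fun _ _ => by simp, fun _ _ => rfl⟩
  smul_mem' := fun t a ha => ⟨fun n m => by simp [ha.1], fun g n => by simp [ha.2]⟩

theorem δ_one_apply {k G V : Type u} [CommRing k] [Group G] [AddCommGroup V] [Module k V]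
    (c : LHS.Cochain (Rep.trivial k G V) 1) (g h : G) :
    LHS.δ (Rep.trivial k G V) 1 c ![g, h] =
      c (fun _ => h) - c (fun _ => g * h) + c (fun _ => g) := by
  have e2 : Fin.contractNth (0 : Fin 2) (· * ·) ![g, h] = fun _ => g * h := by
    ext i; fin_cases i; rfl
  have e3 : Fin.contractNth (1 : Fin 2) (· * ·) ![g, h] = fun _ => g := by
    ext i; fin_cases i; rfl
  simp [LHS.δ, inhomogeneousCochains.d_hom_apply, Fin.sum_univ_two, e2, e3]
  abel

theorem δ_two_apply {k G V : Type u} [CommRing k] [Group G] [AddCommGroup V] [Module k V]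
    (c : LHS.Cochain (Rep.trivial k G V) 2) (g h j : G) :
    LHS.δ (Rep.trivial k G V) 2 c ![g, h, j] =
      c ![h, j] - c ![g * h, j] + c ![g, h * j] - c ![g, h] := by
  have e2 : Fin.contractNth (0 : Fin 3) (· * ·) ![g, h, j] = ![g * h, j] := by
    ext i; fin_cases i <;> rfl
  have e3 : Fin.contractNth (1 : Fin 3) (· * ·) ![g, h, j] = ![g, h * j] := by
    ext i; fin_cases i <;> rfl
  have e4 : Fin.contractNth (2 : Fin 3) (· * ·) ![g, h, j] = ![g, h] := by
    ext i; fin_cases i <;> rfl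
  simp [LHS.δ, inhomogeneousCochains.d_hom_apply, Fin.sum_univ_three, e2, e3, e4, pow_succ]
  abel

theorem δ_two_apply_eq_zero {k N G Q V : Type u} [CommRing k] [Group N] [Group G] [Group Q]
    [AddCommGroup V] [Module k V] (_ : GroupExtension N G Q)
    {c : LHS.Cochain (Rep.trivial k G V) 2} (hc : LHS.δ (Rep.trivial k G V) 2 c = 0) (g h j : G) :
    c ![h, j] - c ![g * h, j] + c ![g, h * j] - c ![g, h] = 0 := by
  rw [← δ_two_apply, hc]
  rfl

theorem vecTwo_eta {G : Type*} (x : Fin 2 → G) : ![x 0, x 1] = x := by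
  ext i; fin_cases i <;> rfl

/-- Elements of `Z_2^{0,1}`: normalized `1`-cochains which are additive on products with one factor
in `N`. -/
theorem mem_Z_zero_one {k N G Q V : Type u} [CommRing k] [Group N] [Group G] [Group Q]
    [AddCommGroup V] [Module k V] (S : GroupExtension N G Q)
    {c : LHS.Cochain (Rep.trivial k G V) 1} :
    c ∈ LHS.Z S.inl.range (Rep.trivial k G V) 2 0 1 ↔ c (fun _ => 1) = 0 ∧
      ∀ g h, (g ∈ S.inl.range ∨ h ∈ S.inl.range) →
        c (fun _ => g * h) = c (fun _ => g) + c (fun _ => h) := by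
  have key : LHS.δ (Rep.trivial k G V) 1 c ∈
      LHS.filtration S.inl.range (Rep.trivial k G V) (0 + 2) (1 + 1) ↔
      ∀ g h, (g ∈ S.inl.range ∨ h ∈ S.inl.range) →
        c (fun _ => g * h) = c (fun _ => g) + c (fun _ => h) := by
    refine LHS.mem_filtration_self.trans ⟨fun H g h hgh => ?_, fun H x hx => ?_⟩
    · have h1 := H ![g, h] (by
        rcases hgh with hg | hg
        · exact ⟨0, hg⟩
        · exact ⟨1, hg⟩)
      rw [δ_one_apply, sub_add_eq_add_sub, sub_eq_zero] at h1
      rw [← h1, add_comm]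
    · have h1 := H (x 0) (x 1) (by
        obtain ⟨i, hi⟩ := hx
        fin_cases i
        · exact Or.inl hi
        · exact Or.inr hi)
      rw [← vecTwo_eta x, δ_one_apply, h1]
      abel
  refine Submodule.mem_inf.trans (and_congr ?_ key)
  refine LHS.mem_filtration_zero.trans ⟨fun H => H _ ⟨0, rfl⟩, fun H x hx => ?_⟩
  obtain ⟨i, hi⟩ := hx
  have : x = fun _ => 1 := by
    ext j; rw [← hi, Subsingleton.elim i j]
  rw [this, H]

/-- Restriction to `N`, from `Z_2^{0,1}` to `Hom(N, V)^G`. -/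
def restrictZ {N G Q V : Type u} (k : Type u) [CommRing k] [Group N] [Group G] [Group Q]
    [AddCommGroup V] [Module k V] (S : GroupExtension N G Q) :
    LHS.Z S.inl.range (Rep.trivial k G V) 2 0 1 →ₗ[k] S.invariantHom k V where
  toFun c := ⟨fun n => c.1 (fun _ => S.inl n), by
    obtain ⟨-, h⟩ := S.mem_Z_zero_one.1 c.2
    refine ⟨fun n m => ?_, fun g n => ?_⟩
    · dsimp only
      rw [map_mul, h _ _ (Or.inl ⟨n, rfl⟩)]
    · have h1 := h (S.inl (S.conjAct g n)) g (Or.inl ⟨_, rfl⟩)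
      have h2 := h g (S.inl n) (Or.inr ⟨_, rfl⟩)
      rw [inl_conjAct_comm, inv_mul_cancel_right, h2, add_comm] at h1
      dsimp only
      rw [inl_conjAct_comm]
      exact (add_right_cancel h1).symm⟩
  map_add' _ _ := rfl
  map_smul' _ _ := rfl

theorem restrictZ_surjective {N G Q V : Type u} (k : Type u) [CommRing k] [Group N] [Group G]
    [Group Q] [AddCommGroup V] [Module k V] (S : GroupExtension N G Q) :
    Function.Surjective (S.restrictZ (V := V) k) := by
  rintro ⟨f, hf, hinv⟩
  have hn : ∀ g : G, ∃ n, S.inl n = g * (S.sec (S.rightHom g))⁻¹ := fun g =>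
    S.exists_inl_eq (by simp)
  choose ν hν using hn
  have hl : ∀ n g, ν (S.inl n * g) = n * ν g := fun n g => by
    apply S.inl_injective
    rw [map_mul, hν, hν]
    simp [mul_assoc]
  have hr : ∀ n g, ν (g * S.inl n) = S.conjAct g n * ν g := fun n g => by
    rw [← hl, inl_conjAct_comm]
    simp
  have hone : f 1 = 0 := by
    have := hf 1 1
    simpa using this
  refine ⟨⟨fun x => f (ν (x 0)) - f (ν 1), S.mem_Z_zero_one.2 ⟨sub_self _, ?_⟩⟩, ?_⟩
  · rintro g h (⟨n, rfl⟩ | ⟨n, rfl⟩)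
    · have := hl n 1
      rw [mul_one] at this
      simp only [hl, hf, this]
      abel
    · have := hl n 1
      rw [mul_one] at this
      simp only [hr, hf, this, hinv]
      abel
  · ext n
    have := hl n 1
    rw [mul_one] at this
    change f (ν (S.inl n)) - f (ν 1) = f n
    rw [this, hf]
    abel

theorem ker_restrictZ {N G Q V : Type u} (k : Type u) [CommRing k] [Group N] [Group G]
    [Group Q] [AddCommGroup V] [Module k V] (S : GroupExtension N G Q) :
    LHS.B S.inl.range (Rep.trivial k G V) 2 0 1 = LinearMap.ker (S.restrictZ (V := V) k) := by
  ext ⟨c, hc⟩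
  rw [LinearMap.mem_ker]
  constructor
  · intro h
    obtain ⟨a, ha, b, hb, hab⟩ := Submodule.mem_sup.1 (Submodule.mem_comap.1 h)
    obtain ⟨b', -, rfl⟩ := hb
    have hb0 : ∀ x, LHS.δ (Rep.trivial k G V) 0 b' x = 0 := fun x => by
      simp only [LHS.δ, inhomogeneousCochains.d_hom_apply]
      rw [Subsingleton.elim (fun i : Fin 0 => x i.succ) (Fin.contractNth 0 (· * ·) x)]
      simp
    ext n
    change c _ = 0
    have hab' : a + LHS.δ (Rep.trivial k G V) 0 b' = c := hab
    rw [← hab', Pi.add_apply, hb0, add_zero]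
    exact LHS.mem_filtration_self.1 ha.1 _ ⟨0, ⟨n, rfl⟩⟩
  · intro h
    apply Submodule.mem_comap.2
    apply Submodule.mem_sup_left
    refine ⟨LHS.mem_filtration_self.2 ?_, hc.2⟩
    rintro x ⟨i, n, hn⟩
    have h1 : c (fun _ => S.inl n) = 0 := congrFun (congrArg Subtype.val h) n
    have h2 : x = fun _ => S.inl n := by
      ext j; rw [hn, Subsingleton.elim (α := Fin 1) i j]
    change c x = 0
    rw [h2, h1]

/-- The identification `E_2^{0,1} ≅ Hom(N, V)^G`, induced by restriction of cochains to `N`. -/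
def edgeZeroOne {N G Q V : Type u} (k : Type u) [CommRing k] [Group N] [Group G] [Group Q]
    [AddCommGroup V] [Module k V] (S : GroupExtension N G Q) :
    LHS.E S.inl.range (Rep.trivial k G V) 2 0 1 ≃ₗ[k] S.invariantHom k V :=
  (Submodule.quotEquivOfEq _ _ (S.ker_restrictZ k)).trans
    ((S.restrictZ k).quotKerEquivOfSurjective (S.restrictZ_surjective k))

theorem δ_eq_zero_of_mem_Z_two {k N G Q V : Type u} [CommRing k] [Group N] [Group G] [Group Q]
    [AddCommGroup V] [Module k V] (S : GroupExtension N G Q)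
    {c : LHS.Cochain (Rep.trivial k G V) 2}
    (hc : c ∈ LHS.Z S.inl.range (Rep.trivial k G V) 2 2 2) :
    LHS.δ (Rep.trivial k G V) 2 c = 0 := by
  funext x
  exact hc.2.2 x (by norm_num)

/-- Elements of `Z_2^{2,0}` depend only on the images of the arguments in `Q`. -/
theorem apply_eq_of_mem_Z_two {k N G Q V : Type u} [CommRing k] [Group N] [Group G] [Group Q]
    [AddCommGroup V] [Module k V] (S : GroupExtension N G Q)
    {c : LHS.Cochain (Rep.trivial k G V) 2}
    (hc : c ∈ LHS.Z S.inl.range (Rep.trivial k G V) 2 2 2) {g g' h h' : G}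
    (hg : S.rightHom g = S.rightHom g') (hh : S.rightHom h = S.rightHom h') :
    c ![g, h] = c ![g', h'] := by
  have hδ := S.δ_eq_zero_of_mem_Z_two hc
  have h0 := LHS.mem_filtration_self.1 hc.1
  obtain ⟨n, hn⟩ := S.exists_inl_eq (e := g * g'⁻¹) (by simp [hg])
  obtain ⟨m, hm⟩ := S.exists_inl_eq (e := h'⁻¹ * h) (by simp [hh])
  have e1 : g = S.inl n * g' := by rw [hn]; group
  have e2 : h = h' * S.inl m := by rw [hm]; group
  have z1 : ∀ x, c ![S.inl n, x] = 0 := fun x => h0 _ ⟨0, n, rfl⟩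
  have z2 : ∀ x, c ![x, S.inl m] = 0 := fun x => h0 _ ⟨1, m, rfl⟩
  have d1 := S.δ_two_apply_eq_zero hδ (S.inl n) g' h
  have d2 := S.δ_two_apply_eq_zero hδ g' h' (S.inl m)
  rw [z1, z1, ← e1, add_zero, sub_zero, sub_eq_zero] at d1
  rw [z2, z2, ← e2, sub_zero, zero_add, sub_eq_zero] at d2
  rw [← d1, d2]

/-- An element of `Z_2^{2,0}`, regarded as a `2`-cocycle on `Q`. -/
def descendZ {N G Q V : Type u} (k : Type u) [CommRing k] [Group N] [Group G] [Group Q]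
    [AddCommGroup V] [Module k V] (S : GroupExtension N G Q) :
    LHS.Z S.inl.range (Rep.trivial k G V) 2 2 2 →ₗ[k]
      groupCohomology.cocycles₂ (Rep.trivial k Q V) where
  toFun c := ⟨fun x => c.1 ![S.sec x.1, S.sec x.2], by
    rw [groupCohomology.mem_cocycles₂_iff]
    intro x y z
    have h := S.δ_two_apply_eq_zero (S.δ_eq_zero_of_mem_Z_two c.2) (S.sec x) (S.sec y) (S.sec z)
    rw [S.apply_eq_of_mem_Z_two c.2 (g := S.sec x * S.sec y) (g' := S.sec (x * y)) (by simp) rfl,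
      S.apply_eq_of_mem_Z_two c.2 (h := S.sec y * S.sec z) (h' := S.sec (y * z)) rfl (by simp)] at h
    change c.1 ![S.sec (x * y), S.sec z] + c.1 ![S.sec x, S.sec y] =
      c.1 ![S.sec y, S.sec z] + c.1 ![S.sec x, S.sec (y * z)]
    rw [← sub_eq_zero, ← neg_eq_zero, ← h]
    abel⟩
  map_add' _ _ := rfl
  map_smul' _ _ := rfl

/-- The map `E_2^{2,0} → H²(Q; V)` sending the class of a cochain `c(g, h) = σ(p(g), p(h))` to the
class of the `2`-cocycle `σ`. -/
def edgeTwoZeroMap {N G Q V : Type u} (k : Type u) [CommRing k] [Group N] [Group G] [Group Q]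
    [AddCommGroup V] [Module k V] (S : GroupExtension N G Q) :
    LHS.E S.inl.range (Rep.trivial k G V) 2 2 2 →ₗ[k]
      groupCohomology.H2 (Rep.trivial k Q V) :=
  Submodule.liftQ _ ((groupCohomology.H2π (Rep.trivial k Q V)).hom ∘ₗ S.descendZ k) (by
    rintro ⟨c, hc⟩ h
    obtain ⟨a, ha, b, hb, hab⟩ := Submodule.mem_sup.1 (Submodule.mem_comap.1 h)
    obtain ⟨b', hb', rfl⟩ := hb
    have ha0 : a = 0 := by
      funext x
      exact ha.1.2 x (by norm_num)
    have hab' : a + LHS.δ (Rep.trivial k G V) 1 b' = c := hab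
    rw [ha0, zero_add] at hab'
    have hb1 : ∀ g h, (g ∈ S.inl.range ∨ h ∈ S.inl.range) → c ![g, h] = 0 := by
      rintro g h (hg | hh)
      · exact LHS.mem_filtration_self.1 hc.1 _ ⟨0, hg⟩
      · exact LHS.mem_filtration_self.1 hc.1 _ ⟨1, hh⟩
    have hb2 : ∀ n, b' (fun _ => S.inl n) = 0 := fun n =>
      (LHS.mem_filtration_self (n := 1) (c := b')).1 hb'.1 (fun _ => S.inl n) ⟨0, n, rfl⟩
    have hb3 : ∀ g g', S.rightHom g = S.rightHom g' → b' (fun _ => g) = b' (fun _ => g') := by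
      intro g g' hg
      obtain ⟨n, hn⟩ := S.exists_inl_eq (e := g * g'⁻¹) (by simp [hg])
      have e1 : g = S.inl n * g' := by rw [hn]; group
      have h1 := hb1 (S.inl n) g' (Or.inl ⟨n, rfl⟩)
      rw [← hab', δ_one_apply, hb2, add_zero, sub_eq_zero, ← e1] at h1
      exact h1.symm
    apply (groupCohomology.H2π_eq_zero_iff _).2
    refine ⟨fun x => b' (fun _ => S.sec x), ?_⟩
    ext ⟨x, y⟩
    change b' (fun _ => S.sec y) - b' (fun _ => S.sec (x * y)) + b' (fun _ => S.sec x) =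
      c ![S.sec x, S.sec y]
    rw [← hab', δ_one_apply, hb3 (S.sec x * S.sec y) (S.sec (x * y)) (by simp)])

theorem edgeTwoZeroMap_injective {N G Q V : Type u} (k : Type u) [CommRing k] [Group N] [Group G]
    [Group Q] [AddCommGroup V] [Module k V] (S : GroupExtension N G Q) :
    Function.Injective (S.edgeTwoZeroMap (V := V) k) := by
  rw [injective_iff_map_eq_zero]
  intro x hx
  obtain ⟨⟨c, hc⟩, rfl⟩ := Submodule.mkQ_surjective _ x
  obtain ⟨T, hT⟩ := (groupCohomology.H2π_eq_zero_iff (S.descendZ k ⟨c, hc⟩)).1 hx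
  have hT' : ∀ x y, T y - T (x * y) + T x = c ![S.sec x, S.sec y] := fun x y =>
    congrFun hT (x, y)
  have hT1 : T 1 = 0 := by
    have h := hT' 1 1
    rw [mul_one, sub_self, zero_add, S.apply_eq_of_mem_Z_two hc (g' := 1) (h' := 1)
      (by simp) (by simp)] at h
    rw [h]
    exact LHS.mem_filtration_self.1 hc.1 _ ⟨0, S.inl.range.one_mem⟩
  have hδ : LHS.δ (Rep.trivial k G V) 1 (fun x => T (S.rightHom (x 0))) = c := by
    funext x
    rw [← vecTwo_eta x, δ_one_apply]
    dsimp only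
    rw [map_mul, hT']
    exact S.apply_eq_of_mem_Z_two hc (by simp) (by simp)
  refine (Submodule.Quotient.mk_eq_zero _).2 (Submodule.mem_comap.2 (Submodule.mem_sup_right ?_))
  refine ⟨fun x => T (S.rightHom (x 0)), ⟨?_, ?_⟩, hδ⟩
  · refine (LHS.mem_filtration_self (n := 1)).2 ?_
    rintro x ⟨i, n, hn⟩
    rw [Subsingleton.elim (α := Fin 1) i 0] at hn
    rw [← hn, rightHom_inl, hT1]
  · rw [SetLike.mem_coe, Submodule.mem_comap, hδ]
    exact hc.1

theorem edgeTwoZeroMap_surjective {N G Q V : Type u} (k : Type u) [CommRing k] [Group N] [Group G]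
    [Group Q] [AddCommGroup V] [Module k V] (S : GroupExtension N G Q) :
    Function.Surjective (S.edgeTwoZeroMap (V := V) k) := by
  intro x
  induction x using groupCohomology.H2_induction_on with
  | h σ =>
    have hσ : ∀ x y z, σ (x * y, z) + σ (x, y) = σ (y, z) + σ (x, y * z) :=
      (groupCohomology.mem_cocycles₂_iff (σ : Q × Q → V)).1 σ.2
    have h1 : ∀ y, σ (1, y) = σ (1, 1) := groupCohomology.cocycles₂_map_one_fst σ
    have h2 : ∀ y, σ (y, 1) = σ (1, 1) := groupCohomology.cocycles₂_map_one_snd σ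
    let c : LHS.Cochain (Rep.trivial k G V) 2 := fun x =>
      (σ (S.rightHom (x 0), S.rightHom (x 1)) - σ (1, 1) : V)
    have hδ : LHS.δ (Rep.trivial k G V) 2 c = 0 := by
      funext x
      have hx : x = ![x 0, x 1, x 2] := by ext i; fin_cases i <;> rfl
      rw [hx, δ_two_apply]
      have h := hσ (S.rightHom (x 0)) (S.rightHom (x 1)) (S.rightHom (x 2))
      simp only [c, Matrix.cons_val_zero, Matrix.cons_val_one, map_mul]
      rw [← sub_eq_zero] at h
      rw [Pi.zero_apply, ← neg_eq_zero, ← h]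
      abel
    have hc : c ∈ LHS.Z S.inl.range (Rep.trivial k G V) 2 2 2 := by
      refine ⟨LHS.mem_filtration_self.2 ?_, ?_⟩
      · rintro x ⟨i, n, hn⟩
        change (σ (S.rightHom (x 0), S.rightHom (x 1)) - σ (1, 1) : V) = 0
        fin_cases i
        · rw [show x 0 = S.inl n from hn.symm, rightHom_inl, h1, sub_self]
        · rw [show x 1 = S.inl n from hn.symm, rightHom_inl, h2, sub_self]
      · rw [SetLike.mem_coe, Submodule.mem_comap, hδ]
        exact Submodule.zero_mem _
    refine ⟨Submodule.Quotient.mk ⟨c, hc⟩, ?_⟩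
    change groupCohomology.H2π _ (S.descendZ k ⟨c, hc⟩) = _
    rw [groupCohomology.H2π_eq_iff]
    refine ⟨fun _ => (-σ (1, 1) : V), ?_⟩
    ext ⟨x, y⟩
    change (-σ (1, 1) - -σ (1, 1) + -σ (1, 1) : V) =
      (σ (S.rightHom (S.sec x), S.rightHom (S.sec y)) - σ (1, 1)) - σ (x, y)
    rw [rightHom_sec, rightHom_sec]
    abel

/-- The identification `E_2^{2,0} ≅ H²(Q; V)`. -/
def edgeTwoZero {N G Q V : Type u} (k : Type u) [CommRing k] [Group N] [Group G] [Group Q]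
    [AddCommGroup V] [Module k V] (S : GroupExtension N G Q) :
    LHS.E S.inl.range (Rep.trivial k G V) 2 2 2 ≃ₗ[k]
      groupCohomology.H2 (Rep.trivial k Q V) :=
  LinearEquiv.ofBijective (S.edgeTwoZeroMap k)
    ⟨S.edgeTwoZeroMap_injective k, S.edgeTwoZeroMap_surjective k⟩

/-- The transgression `d₂ : Hom(N, V)^G → H²(Q; V)`: the differential
`d₂ : E_2^{0,1} → E_2^{2,0}` read through the identifications of both terms. -/
def transgression {N G Q V : Type u} (k : Type u) [CommRing k] [Group N] [Group G] [Group Q]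
    [AddCommGroup V] [Module k V] (S : GroupExtension N G Q) :
    S.invariantHom k V →ₗ[k] groupCohomology.H2 (Rep.trivial k Q V) :=
  (S.edgeTwoZero k).toLinearMap ∘ₗ LHS.d S.inl.range (Rep.trivial k G V) 2 0 1 ∘ₗ
    (S.edgeZeroOne k).symm.toLinearMap

end GroupExtension

/-! ### Diffeomorphisms of the circle and their lifts to the line -/

/-- `Diff⁺(S¹)`: the smooth diffeomorphisms of the circle which preserve the orientation, i.e.
which lift along `t ↦ exp(it)` to an increasing homeomorphism of the line. -/
def DiffCircle : Subgroup (Equiv.Perm Circle) where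
  carrier := {φ | ContMDiff (𝓡 1) (𝓡 1) ∞ φ ∧ ContMDiff (𝓡 1) (𝓡 1) ∞ φ.symm ∧
    ∃ F : ℝ ≃o ℝ, ∀ t, φ (Circle.exp t) = Circle.exp (F t)}
  mul_mem' := by
    rintro a b ⟨ha, ha', F, hF⟩ ⟨hb, hb', F', hF'⟩
    exact ⟨ha.comp hb, hb'.comp ha', F'.trans F, fun t => by simp [hF, hF']⟩
  one_mem' := ⟨contMDiff_id, contMDiff_id, OrderIso.refl ℝ, fun _ => rfl⟩
  inv_mem' := by
    rintro a ⟨ha, ha', F, hF⟩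
    refine ⟨ha', ha, F.symm, fun t => ?_⟩
    rw [Equiv.Perm.inv_eq_iff_eq, hF, OrderIso.apply_symm_apply]

/-- The universal covering group `H` of `Diff⁺(S¹)`: the increasing smooth diffeomorphisms `F` of
the line with `F(t + 2π) = F(t) + 2π`. -/
def DiffCircleCover : Subgroup (ℝ ≃o ℝ) where
  carrier := {F | ContDiff ℝ ∞ F ∧ ContDiff ℝ ∞ F.symm ∧
    ∀ t, F (t + 2 * Real.pi) = F t + 2 * Real.pi}
  mul_mem' := by
    rintro a b ⟨ha, ha', h⟩ ⟨hb, hb', h'⟩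
    exact ⟨ha.comp hb, hb'.comp ha', fun t => by simp [RelIso.mul_apply, h, h']⟩
  one_mem' := ⟨contDiff_id, contDiff_id, fun _ => rfl⟩
  inv_mem' := by
    rintro a ⟨ha, ha', h⟩
    refine ⟨ha', ha, fun t => ?_⟩
    apply a.injective
    change a (a.symm _) = a (a.symm t + _)
    rw [h, OrderIso.apply_symm_apply, OrderIso.apply_symm_apply]

/-- The inclusion `ℤ → ℝ`, as a homomorphism of multiplicatively written groups. -/
def intToReal : Multiplicative ℤ →* Multiplicative ℝ :=
  AddMonoidHom.toMultiplicative (Int.castAddHom ℝ)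

/-! ### Symplectomorphisms of the closed disk and the Calabi invariant -/

/-- The closed unit disk `D` in the plane `ℝ² = ℂ`. -/
abbrev unitDisk : Set ℂ := Metric.closedBall 0 1

/-- The standard symplectic form `ω = dx ∧ dy`. -/
def stdSymplectic (u v : ℂ) : ℝ := u.re * v.im - u.im * v.re

open Classical in
/-- A self-map of `D` as a map `ℂ → ℂ`; the values outside `D` play no role. -/
def diskFun (g : Equiv.Perm unitDisk) (z : ℂ) : ℂ :=
  if h : z ∈ unitDisk then (g ⟨z, h⟩ : ℂ) else z

theorem diskFun_of_mem (g : Equiv.Perm unitDisk) {z : ℂ} (h : z ∈ unitDisk) :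
    diskFun g z = g ⟨z, h⟩ := dif_pos h

theorem mapsTo_diskFun (g : Equiv.Perm unitDisk) : Set.MapsTo (diskFun g) unitDisk unitDisk :=
  fun z h => by rw [diskFun_of_mem g h]; exact (g ⟨z, h⟩).2

theorem diskFun_mul (g h : Equiv.Perm unitDisk) : diskFun (g * h) = diskFun g ∘ diskFun h := by
  funext z
  by_cases hz : z ∈ unitDisk
  · rw [Function.comp_apply, diskFun_of_mem _ hz, diskFun_of_mem h hz,
      diskFun_of_mem g (h ⟨z, hz⟩).2]
    rfl
  · have e : ∀ k : Equiv.Perm unitDisk, diskFun k z = z := fun k => dif_neg hz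
    rw [Function.comp_apply, e h, e, e]

theorem diskFun_one : diskFun 1 = id := by
  funext z
  by_cases hz : z ∈ unitDisk
  · rw [diskFun_of_mem _ hz]; rfl
  · simp only [diskFun, dif_neg hz, id]

theorem uniqueDiffOn_unitDisk : UniqueDiffOn ℝ unitDisk :=
  uniqueDiffOn_convex (convex_closedBall 0 1) (by
    rw [interior_closedBall 0 one_ne_zero]
    exact ⟨0, by simp⟩)

/-- `G = Symp(D, ω)`: the diffeomorphisms of `D`, smooth up to the boundary, with `g^*ω = ω`. -/
def SympDisk : Subgroup (Equiv.Perm unitDisk) where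
  carrier := {g | ContDiffOn ℝ ∞ (diskFun g) unitDisk ∧ ContDiffOn ℝ ∞ (diskFun g⁻¹) unitDisk ∧
    ∀ z ∈ unitDisk, ∀ u v : ℂ,
      stdSymplectic (fderivWithin ℝ (diskFun g) unitDisk z u)
        (fderivWithin ℝ (diskFun g) unitDisk z v) = stdSymplectic u v}
  mul_mem' := by
    rintro a b ⟨ha, ha', h⟩ ⟨hb, hb', h'⟩
    refine ⟨?_, ?_, fun z hz u v => ?_⟩
    · rw [diskFun_mul]
      exact ha.comp hb (mapsTo_diskFun b)
    · rw [mul_inv_rev, diskFun_mul]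
      exact hb'.comp ha' (mapsTo_diskFun _)
    · rw [diskFun_mul, fderivWithin_comp z
        (ha.differentiableOn (by simp) _ (mapsTo_diskFun b hz))
        (hb.differentiableOn (by simp) z hz) (mapsTo_diskFun b) (uniqueDiffOn_unitDisk z hz)]
      simp only [ContinuousLinearMap.comp_apply]
      rw [h _ (mapsTo_diskFun b hz), h' z hz]
  one_mem' := by
    refine ⟨?_, ?_, fun z hz u v => ?_⟩
    · rw [diskFun_one]; exact contDiffOn_id
    · rw [inv_one, diskFun_one]; exact contDiffOn_id
    · rw [diskFun_one, fderivWithin_id (uniqueDiffOn_unitDisk z hz)]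
      rfl
  inv_mem' := by
    rintro a ⟨ha, ha', h⟩
    refine ⟨ha', by rwa [inv_inv], fun z hz u v => ?_⟩
    have hm := mapsTo_diskFun a⁻¹ hz
    have hc := fderivWithin_comp z (ha.differentiableOn (by simp) _ hm)
      (ha'.differentiableOn (by simp) z hz) (mapsTo_diskFun a⁻¹) (uniqueDiffOn_unitDisk z hz)
    rw [← diskFun_mul, mul_inv_cancel, diskFun_one,
      fderivWithin_id (uniqueDiffOn_unitDisk z hz)] at hc
    have hw : ∀ w, fderivWithin ℝ (diskFun a) unitDisk (diskFun a⁻¹ z)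
        (fderivWithin ℝ (diskFun a⁻¹) unitDisk z w) = w := fun w =>
      (congrArg (fun L : ℂ →L[ℝ] ℂ => L w) hc).symm
    rw [← h _ hm, hw, hw]

/-- `G_rel`: the symplectomorphisms which are the identity on the boundary circle `∂D`. -/
def SympDiskRel : Subgroup SympDisk where
  carrier := {g | ∀ z : unitDisk, ‖(z : ℂ)‖ = 1 → g.1 z = z}
  mul_mem' := by
    intro a b ha hb z hz
    change a.1 (b.1 z) = z
    rw [hb z hz, ha z hz]
  one_mem' := fun _ _ => rfl
  inv_mem' := by
    intro a ha z hz
    exact Equiv.Perm.inv_eq_iff_eq.2 (ha z hz).symm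

/-- A point of the circle as a point of `∂D ⊆ D`. -/
def circleToDisk (z : Circle) : unitDisk := ⟨z, by simp [Circle.norm_coe]⟩

/-- The wedge product of two covectors. -/
def wedge (α β : ℂ →L[ℝ] ℝ) (u v : ℂ) : ℝ := α u * β v - α v * β u

/-- `η` is a smooth `1`-form on `D` with `dη = ω`, where
`dη_z(u, v) = (D_u η)(v) - (D_v η)(u)`. -/
def IsPrimitive (η : ℂ → ℂ →L[ℝ] ℝ) : Prop :=
  ContDiffOn ℝ ∞ η unitDisk ∧ ∀ z ∈ unitDisk, ∀ u v : ℂ,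
    fderivWithin ℝ η unitDisk z u v - fderivWithin ℝ η unitDisk z v u = stdSymplectic u v

/-- The pull-back `g^*η` of a `1`-form on `D`. -/
def pullback (g : Equiv.Perm unitDisk) (η : ℂ → ℂ →L[ℝ] ℝ) (z : ℂ) : ℂ →L[ℝ] ℝ :=
  (η (diskFun g z)).comp (fderivWithin ℝ (diskFun g) unitDisk z)

/-- The Calabi integral `-∫_D η ∧ h^*η`, where `D` is oriented by `dx ∧ dy`, i.e. by the basis
`(1, i)` of `ℂ`. -/
def calabi (η : ℂ → ℂ →L[ℝ] ℝ) (h : Equiv.Perm unitDisk) : ℝ :=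
  -∫ z in unitDisk, wedge (η z) (pullback h η z) 1 Complex.I

/-- The `1`-form `(x dy - y dx) / 2`. -/
def stdPrimitive (z : ℂ) : ℂ →L[ℝ] ℝ :=
  (1 / 2 : ℝ) • (z.re • Complex.imCLM - z.im • Complex.reCLM)

theorem isPrimitive_stdPrimitive : IsPrimitive stdPrimitive := by
  let L : ℂ →L[ℝ] ℂ →L[ℝ] ℝ := (1 / 2 : ℝ) •
    (Complex.reCLM.smulRight Complex.imCLM - Complex.imCLM.smulRight Complex.reCLM)
  have hL : stdPrimitive = L := rfl
  refine ⟨hL ▸ L.contDiff.contDiffOn, fun z hz u v => ?_⟩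
  rw [hL, L.fderivWithin (uniqueDiffOn_unitDisk z hz)]
  simp [L, stdSymplectic]
  ring

end

open scoped ContDiff Manifold
open MeasureTheory

noncomputable section

/-! ### Maps of the circle and their lifts to the line -/

/-! The Calabi integral makes sense on all of `G`, not only on `G_rel`: fix `η = (x dy - y dx) / 2`
and put `c(g) = -∫ η ∧ g^*η`. It is not a homomorphism there, but its coboundary sees only boundary
values. Since `h` preserves area, `δc(g, h) = -∫ (η - h^*η) ∧ (h^*η - h^*g^*η)`
(`calabi_coboundary`). Both factors are closed, because pull-backs of primitives of `ω` are
primitives, so Stokes turns this into an integral over the circle. There `η` is `dθ / 2`, and if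
`F₁`, `F₂` are lifts of the boundary maps of `g`, `h`, one integration by parts gives `δc(g, h) =
τ(F₂) - τ(F₁F₂) + τ(F₁)`, where `τ(F)` is a quarter of the integral of `F` over `[-π, π]`
(`calabi_coboundary_eq`).

So `δc` is the coboundary of a function `τ` on the central extension `H`, and translating a lift by
`2πn` adds `(1/4)(2π)(2πn) = π²n` to `τ`. The rest is algebra
(`smul_extensionClassAlong_eq_neg_transgression`). As `1` is a lift of every element of `G_rel` and
`τ(1) = 0`, the cochain `c` is additive on products with one factor in `G_rel`. Hence its
restriction `Cal` is an invariant homomorphism, and `d₂ Cal` is the class of `δc` on `Diff⁺(S¹)`. If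
lifts `e(x)` satisfy `e(x)e(y) = n(x,y)·e(xy)`, then `δc = δ(τ∘e) - π² n`, so `d₂ Cal = -π² e(H_ℝ)`.

Independence of `Cal` from the primitive is again Stokes (`calabi_eq_of_isPrimitive`). The extension
by `G_rel` requires two geometric facts. The boundary map of a symplectomorphism is an
orientation-preserving circle diffeomorphism (`norm_diskFun_lt_one`, `deriv_lift_pos`). Conversely
every such diffeomorphism extends to the disk, by an explicit generating function in the coordinates
`(r², θ)` (`exists_stripEquiv`). -/

theorem Complex.contDiffAt_arg {z : ℂ} (hz : z ∈ Complex.slitPlane) :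
    ContDiffAt ℝ ∞ Complex.arg z := by
  have h := Complex.imCLM.contDiff.contDiffAt.comp z
    ((Complex.contDiffAt_log hz (n := ∞)).restrict_scalars ℝ)
  exact h.congr_of_eventuallyEq (Filter.Eventually.of_forall fun w => (Complex.log_im w).symm)

theorem Circle.contDiff_coe_exp : ContDiff ℝ ∞ fun t : ℝ => (Circle.exp t : ℂ) := by
  simp only [Circle.coe_exp]
  exact ((Complex.ofRealCLM.contDiff.mul contDiff_const).cexp)

theorem Circle.hasDerivAt_coe_exp (t : ℝ) :
    HasDerivAt (fun t : ℝ => (Circle.exp t : ℂ)) (Complex.I * Circle.exp t) t := by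
  simp only [Circle.coe_exp]
  have := ((Complex.ofRealCLM.hasDerivAt (x := t)).mul_const Complex.I).cexp
  simpa [mul_comm] using this

/-- Supplies the branch `w ↦ t + arg(w / exp(it))` of the inverse of the covering map, smooth near
`exp(it)`. -/
theorem Circle.exp_add_arg_div (z : Circle) (t : ℝ) :
    Circle.exp (t + Complex.arg ((z : ℂ) / Circle.exp t)) = z := by
  have h := Circle.exp_arg (z / Circle.exp t)
  rw [Circle.coe_div] at h
  rw [Circle.exp_add, h, mul_div_cancel]

/-- By continuity `F` stays within `π` of `F t₀` near `t₀`, and there it is recovered from its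
exponential by the smooth branch of the logarithm centred at `F t₀`. -/
theorem contDiff_of_contDiff_circleExp {F : ℝ → ℝ} (hF : Continuous F)
    (h : ContDiff ℝ ∞ fun t => (Circle.exp (F t) : ℂ)) : ContDiff ℝ ∞ F := by
  rw [contDiff_iff_contDiffAt]
  intro t₀
  have h1 : ContDiffAt ℝ ∞
      (fun t => F t₀ + Complex.arg ((Circle.exp (F t) : ℂ) / Circle.exp (F t₀))) t₀ := by
    refine contDiffAt_const.add ?_
    refine ContDiffAt.comp (g := Complex.arg) t₀ (Complex.contDiffAt_arg ?_)
      (h.contDiffAt.div_const _)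
    simp [Complex.slitPlane]
  refine h1.congr_of_eventuallyEq ?_
  have h2 : ∀ᶠ t in nhds t₀, |F t - F t₀| < Real.pi := by
    have := Metric.tendsto_nhds.1 (hF.tendsto t₀) Real.pi Real.pi_pos
    simpa [Real.dist_eq] using this
  filter_upwards [h2] with t ht
  rw [abs_lt] at ht
  rw [← Circle.coe_div, ← Circle.exp_sub, Circle.arg_exp ht.1 ht.2.le]
  ring

attribute [local instance] finrank_real_complex_fact'

/-- Reduces smoothness on the circle as a manifold to calculus on the line. For the converse, near
`exp(it₀)` the map factors through a smooth local inverse of `t ↦ exp(it)` defined on an open set of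
the plane. -/
theorem contMDiff_circle_iff {φ : Circle → Circle} :
    ContMDiff (𝓡 1) (𝓡 1) ∞ φ ↔ ContDiff ℝ ∞ fun t => (φ (Circle.exp t) : ℂ) := by
  constructor
  · intro h
    have h1 : ContMDiff (𝓡 1) 𝓘(ℝ, ℂ) ∞ (fun z : Circle => (φ z : ℂ)) :=
      contMDiff_coe_sphere.comp h
    exact (h1.comp contMDiff_circleExp).contDiff
  · intro h
    have h1 : ContMDiff (𝓡 1) 𝓘(ℝ, ℂ) ∞ (fun z : Circle => (φ z : ℂ)) := by
      intro z₀
      obtain ⟨t₀, rfl⟩ := Circle.exp_surjective z₀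
      have h2 : ContDiffAt ℝ ∞ (fun w : ℂ =>
          (φ (Circle.exp (t₀ + Complex.arg (w / Circle.exp t₀))) : ℂ)) (Circle.exp t₀) := by
        refine ContDiffAt.comp (g := fun t => (φ (Circle.exp t) : ℂ)) _ h.contDiffAt ?_
        refine contDiffAt_const.add (ContDiffAt.comp (g := Complex.arg) _
          (Complex.contDiffAt_arg ?_) (contDiffAt_id.div_const _))
        simp [Complex.slitPlane]
      have h3 : ContMDiff (𝓡 1) 𝓘(ℝ, ℂ) ∞ (fun z : Circle => (z : ℂ)) := contMDiff_coe_sphere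
      have h4 := h2.contMDiffAt.comp (Circle.exp t₀) h3.contMDiffAt
      refine h4.congr_of_eventuallyEq (Filter.Eventually.of_forall fun z => ?_)
      change (φ z : ℂ) = φ (Circle.exp (t₀ + Complex.arg ((z : ℂ) / Circle.exp t₀)))
      rw [Circle.exp_add_arg_div]
    exact h1.codRestrict_sphere fun z => by
      rw [mem_sphere_zero_iff_norm, Circle.norm_coe]

theorem Circle.eq_add_of_exp_eq {x y : ℝ} (h : Circle.exp x = Circle.exp y) :
    ∃ m : ℤ, x = y + 2 * Real.pi * m := by
  obtain ⟨m, hm⟩ := Circle.exp_eq_exp.1 h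
  exact ⟨m, by rw [hm]; ring⟩

/-! ### The covering group and its projection to the circle diffeomorphisms. -/

namespace DiffCircleCover

theorem contDiff (F : DiffCircleCover) : ContDiff ℝ ∞ F.1 := F.2.1

theorem map_add_two_pi (F : DiffCircleCover) (t : ℝ) : F.1 (t + 2 * Real.pi) = F.1 t + 2 * Real.pi :=
  F.2.2.2 t

theorem exp_apply_congr (F : DiffCircleCover) {s t : ℝ} (h : Circle.exp s = Circle.exp t) :
    Circle.exp (F.1 s) = Circle.exp (F.1 t) := by
  have hp : Function.Periodic (fun t => Circle.exp (F.1 t)) (2 * Real.pi) := fun t => by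
    simp only [map_add_two_pi F, Circle.exp_add_two_pi]
  obtain ⟨m, rfl⟩ := Circle.exp_eq_exp.1 h
  exact hp.int_mul m t

/-- The diffeomorphism of the circle covered by `F`. -/
def toPerm (F : DiffCircleCover) : Equiv.Perm Circle where
  toFun z := Circle.exp (F.1 (Complex.arg z))
  invFun z := Circle.exp (F⁻¹.1 (Complex.arg z))
  left_inv z := by
    have h := exp_apply_congr F⁻¹ (Circle.exp_arg (Circle.exp (F.1 (Complex.arg z))))
    refine h.trans ?_
    change Circle.exp (F.1.symm (F.1 _)) = z
    rw [OrderIso.symm_apply_apply, Circle.exp_arg]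
  right_inv z := by
    have h := exp_apply_congr F (Circle.exp_arg (Circle.exp (F⁻¹.1 (Complex.arg z))))
    refine h.trans ?_
    change Circle.exp (F.1 (F.1.symm _)) = z
    rw [OrderIso.apply_symm_apply, Circle.exp_arg]

theorem toPerm_exp (F : DiffCircleCover) (t : ℝ) :
    (toPerm F) (Circle.exp t) = Circle.exp (F.1 t) :=
  exp_apply_congr F (Circle.exp_arg _)

theorem toPerm_symm_exp (F : DiffCircleCover) (t : ℝ) :
    (toPerm F).symm (Circle.exp t) = Circle.exp (F⁻¹.1 t) :=
  exp_apply_congr F⁻¹ (Circle.exp_arg _)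

theorem toPerm_mem (F : DiffCircleCover) : (toPerm F) ∈ DiffCircle := by
  refine ⟨contMDiff_circle_iff.2 ?_, contMDiff_circle_iff.2 ?_, F.1, toPerm_exp F⟩
  · simp only [toPerm_exp]
    exact Circle.contDiff_coe_exp.comp (contDiff F)
  · simp only [toPerm_symm_exp]
    exact Circle.contDiff_coe_exp.comp (contDiff F⁻¹)

/-- The covering projection `H → Diff⁺(S¹)`. -/
def proj : DiffCircleCover →* DiffCircle where
  toFun F := ⟨(toPerm F), toPerm_mem F⟩
  map_one' := by
    ext z : 2
    exact Circle.exp_arg z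
  map_mul' F G := by
    ext z : 2
    obtain ⟨t, rfl⟩ := Circle.exp_surjective z
    change toPerm (F * G) _ = toPerm F (toPerm G _)
    rw [toPerm_exp, toPerm_exp, toPerm_exp]
    rfl

theorem proj_exp (F : DiffCircleCover) (t : ℝ) :
    (proj F).1 (Circle.exp t) = Circle.exp (F.1 t) := toPerm_exp F t

/-- The increment over a period is `2πm` with `m > 0` by monotonicity. If `m ≥ 2`, some `s` strictly
between `t` and `t + 2π` has `F s = F t + 2π`, so `φ` would identify two distinct points of the
circle. -/
theorem map_add_of_exp {φ : Equiv.Perm Circle} {F : ℝ ≃o ℝ}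
    (h : ∀ t, φ (Circle.exp t) = Circle.exp (F t)) (t : ℝ) :
    F (t + 2 * Real.pi) = F t + 2 * Real.pi := by
  have h1 : Circle.exp (F (t + 2 * Real.pi)) = Circle.exp (F t) := by
    rw [← h, ← h, Circle.exp_add_two_pi]
  obtain ⟨m, hm⟩ := Circle.eq_add_of_exp_eq h1
  have hpi := Real.pi_pos
  have hlt : F t < F (t + 2 * Real.pi) := F.strictMono (by linarith)
  have hm0 : 0 < m := by
    have : (0 : ℝ) < m := by
      rw [hm] at hlt
      by_contra hc
      nlinarith
    exact_mod_cast this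
  rcases (show m = 1 ∨ 2 ≤ m by omega) with rfl | h2
  · rw [hm]; simp
  · exfalso
    have h2' : (2 : ℝ) ≤ m := by exact_mod_cast h2
    obtain ⟨s, hs⟩ := F.surjective (F t + 2 * Real.pi)
    have hs1 : t < s := F.lt_iff_lt.1 (by linarith)
    have hs2 : s < t + 2 * Real.pi := F.lt_iff_lt.1 (by rw [hs, hm]; nlinarith)
    have h3 : Circle.exp s = Circle.exp t := by
      apply φ.injective
      rw [h, h, hs, Circle.exp_add_two_pi]
    obtain ⟨k, hk⟩ := Circle.eq_add_of_exp_eq h3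
    have k1 : (0 : ℝ) < k := by by_contra hc; nlinarith
    have k2 : (k : ℝ) < 1 := by by_contra hc; nlinarith
    have k1' : 0 < k := by exact_mod_cast k1
    have k2' : k < 1 := by exact_mod_cast k2
    omega

theorem proj_surjective : Function.Surjective proj := by
  rintro ⟨φ, h1, h2, F, hF⟩
  have hF' : ∀ t, φ.symm (Circle.exp t) = Circle.exp (F.symm t) := fun t => by
    rw [Equiv.symm_apply_eq, hF, OrderIso.apply_symm_apply]
  rw [contMDiff_circle_iff] at h1 h2
  simp only [hF] at h1
  simp only [hF'] at h2
  refine ⟨⟨F, contDiff_of_contDiff_circleExp F.continuous h1,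
    contDiff_of_contDiff_circleExp F.symm.continuous h2, map_add_of_exp hF⟩, ?_⟩
  ext z : 2
  obtain ⟨t, rfl⟩ := Circle.exp_surjective z
  rw [proj_exp, hF]

/-- The translations by multiples of `2π`. -/
def translation : Multiplicative ℤ →* DiffCircleCover where
  toFun n := ⟨OrderIso.addRight (2 * Real.pi * (Multiplicative.toAdd n : ℤ)),
    contDiff_id.add contDiff_const, contDiff_id.add contDiff_const, fun t => by
      simp only [OrderIso.addRight_apply]; ring⟩
  map_one' := by
    ext t
    change t + 2 * Real.pi * ((0 : ℤ) : ℝ) = t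
    simp
  map_mul' m n := by
    ext t
    change t + 2 * Real.pi * ((Multiplicative.toAdd m + Multiplicative.toAdd n : ℤ) : ℝ) =
      (t + 2 * Real.pi * (Multiplicative.toAdd n : ℤ)) + 2 * Real.pi * (Multiplicative.toAdd m : ℤ)
    push_cast
    ring

/-- `(F(t) - t) / 2π` is continuous and integer-valued, hence constant. -/
theorem proj_eq_one_iff {F : DiffCircleCover} :
    proj F = 1 ↔ ∃ n : ℤ, ∀ t, F.1 t = t + 2 * Real.pi * n := by
  constructor
  · intro h
    have h1 : ∀ t, Circle.exp (F.1 t) = Circle.exp t := fun t => by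
      rw [← proj_exp, h]; rfl
    choose n hn using fun t => Circle.eq_add_of_exp_eq (h1 t)
    have hpi : 2 * Real.pi ≠ 0 := by positivity
    have hc : Continuous fun t => (n t : ℝ) := by
      have : (fun t => (n t : ℝ)) = fun t => (F.1 t - t) / (2 * Real.pi) := by
        funext t
        rw [hn t]
        field_simp
        ring
      rw [this]
      exact (F.1.continuous.sub continuous_id).div_const _
    have hc' : Continuous n := Int.isClosedEmbedding_coe_real.isEmbedding.continuous_iff.2 hc
    refine ⟨n 0, fun t => ?_⟩
    rw [hn t, PreconnectedSpace.constant inferInstance hc' (x := t) (y := 0)]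
  · rintro ⟨n, hn⟩
    ext z : 2
    obtain ⟨t, rfl⟩ := Circle.exp_surjective z
    rw [proj_exp, hn, Circle.exp_add, Circle.exp_two_pi_mul_int, mul_one]
    rfl

theorem map_add_int_mul (F : DiffCircleCover) (t : ℝ) (n : ℤ) :
    F.1 (t + 2 * Real.pi * n) = F.1 t + 2 * Real.pi * n := by
  have hp : Function.Periodic (fun t => F.1 t - t) (2 * Real.pi) := fun t => by
    simp only [map_add_two_pi F]; ring
  have h := hp.int_mul n t
  rw [show t + 2 * Real.pi * n = t + n * (2 * Real.pi) by ring]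
  linarith

theorem range_translation_le_center : translation.range ≤ Subgroup.center DiffCircleCover := by
  rintro _ ⟨n, rfl⟩
  rw [Subgroup.mem_center_iff]
  intro F
  ext t
  exact map_add_int_mul F t (Multiplicative.toAdd n)

end DiffCircleCover

/-- The central extension `0 → ℤ → H → Diff⁺(S¹) → 1`. -/
def circleExtension : GroupExtension (Multiplicative ℤ) DiffCircleCover DiffCircle where
  inl := DiffCircleCover.translation
  rightHom := DiffCircleCover.proj
  inl_injective := by
    intro m n h
    have h1 := congrArg (fun F : DiffCircleCover => F.1 0) h
    change 0 + 2 * Real.pi * ((Multiplicative.toAdd m : ℤ) : ℝ) =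
      0 + 2 * Real.pi * ((Multiplicative.toAdd n : ℤ) : ℝ) at h1
    have hpi := Real.pi_pos
    rw [zero_add, zero_add, mul_right_inj' (by positivity)] at h1
    exact Multiplicative.toAdd.injective (by exact_mod_cast h1)
  range_inl_eq_ker_rightHom := by
    ext F
    rw [MonoidHom.mem_ker, DiffCircleCover.proj_eq_one_iff]
    constructor
    · rintro ⟨n, rfl⟩
      exact ⟨Multiplicative.toAdd n, fun t => rfl⟩
    · rintro ⟨n, hn⟩
      exact ⟨Multiplicative.ofAdd n, by ext t; exact (hn t).symm⟩
  rightHom_surjective := DiffCircleCover.proj_surjective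

/-! ### Stokes' theorem on the disk -/

/-- Alternating bilinear forms on the plane are a line spanned by `ω`, so they are determined by
their value on `(1, i)`. -/
theorem clm_sub_swap_eq_stdSymplectic_mul (L : ℂ →L[ℝ] ℂ →L[ℝ] ℝ) (u v : ℂ) :
    L u v - L v u = stdSymplectic u v * (L 1 Complex.I - L Complex.I 1) := by
  have hu : u = u.re • (1 : ℂ) + u.im • Complex.I := by simp
  have hv : v = v.re • (1 : ℂ) + v.im • Complex.I := by simp
  conv_lhs => rw [hu, hv]
  simp only [map_add, map_smul, add_apply, smul_apply,
    smul_eq_mul, stdSymplectic]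
  ring

theorem wedge_map_eq_stdSymplectic_mul (α β : ℂ →L[ℝ] ℝ) (u v : ℂ) :
    wedge α β u v = stdSymplectic u v * wedge α β 1 Complex.I := by
  have := clm_sub_swap_eq_stdSymplectic_mul (α.smulRight β) u v
  simpa [wedge] using this

theorem Circle.stdSymplectic_I_mul (z : Circle) : stdSymplectic (z : ℂ) (Complex.I * z) = 1 := by
  have h := z.normSq_coe
  rw [Complex.normSq_apply] at h
  simp [stdSymplectic, h]

/-- Polar coordinates. -/
def polarMap (p : ℝ × ℝ) : ℂ := p.1 * (Circle.exp p.2 : ℂ)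

theorem polarMap_eq (p : ℝ × ℝ) : Complex.polarCoord.symm p = polarMap p := by
  rw [Complex.polarCoord_symm_apply, polarMap, Circle.coe_exp, Complex.exp_mul_I]
  simp

theorem norm_polarMap (p : ℝ × ℝ) : ‖polarMap p‖ = |p.1| := by
  rw [← polarMap_eq, Complex.norm_polarCoord_symm]

theorem continuous_polarMap : Continuous polarMap := by
  unfold polarMap
  fun_prop

theorem hasFDerivAt_circleExp_snd (p : ℝ × ℝ) :
    HasFDerivAt (fun p : ℝ × ℝ => (Circle.exp p.2 : ℂ))
      ((ContinuousLinearMap.snd ℝ ℝ ℝ).smulRight (Complex.I * Circle.exp p.2)) p := by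
  have h := (Circle.hasDerivAt_coe_exp p.2).hasFDerivAt.comp p
    (ContinuousLinearMap.snd ℝ ℝ ℝ).hasFDerivAt
  refine HasFDerivAt.congr_fderiv (f' := _) h ?_
  ext <;> simp

theorem hasFDerivAt_polarMap (p : ℝ × ℝ) :
    HasFDerivAt polarMap ((ContinuousLinearMap.fst ℝ ℝ ℝ).smulRight (Circle.exp p.2 : ℂ) +
      (ContinuousLinearMap.snd ℝ ℝ ℝ).smulRight (Complex.I * polarMap p)) p := by
  have h := (Complex.ofRealCLM.hasFDerivAt.comp p
    (ContinuousLinearMap.fst ℝ ℝ ℝ).hasFDerivAt).mul (hasFDerivAt_circleExp_snd p)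
  refine HasFDerivAt.congr_fderiv (f' := _) h ?_
  ext
  · simp
  · simp [polarMap]
    ring

/-- The exterior derivative of a `1`-form on the disk, evaluated on the basis `(1, i)`. -/
def diskExtDeriv (β : ℂ → ℂ →L[ℝ] ℝ) (z : ℂ) : ℝ :=
  fderivWithin ℝ β unitDisk z 1 Complex.I - fderivWithin ℝ β unitDisk z Complex.I 1

/-- The integral of a `1`-form over the boundary circle. -/
def circleForm (β : ℂ → ℂ →L[ℝ] ℝ) : ℝ :=
  ∫ t in -Real.pi..Real.pi, β (Circle.exp t) (Complex.I * Circle.exp t)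

theorem continuousOn_diskExtDeriv {β : ℂ → ℂ →L[ℝ] ℝ} (hβ : ContDiffOn ℝ ∞ β unitDisk) :
    ContinuousOn (diskExtDeriv β) unitDisk := by
  have h := hβ.continuousOn_fderivWithin uniqueDiffOn_unitDisk (by simp)
  exact ((h.clm_apply continuousOn_const).clm_apply continuousOn_const).sub
    ((h.clm_apply continuousOn_const).clm_apply continuousOn_const)

theorem ContinuousOn.integrableOn_unitDisk {f : ℂ → ℝ} (hf : ContinuousOn f unitDisk) :
    IntegrableOn f unitDisk :=
  hf.integrableOn_compact (isCompact_closedBall 0 1)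

theorem circle_mem_unitDisk (z : Circle) : (z : ℂ) ∈ unitDisk := by
  rw [unitDisk, mem_closedBall_zero_iff, Circle.norm_coe]

theorem polarMap_mem_unitDisk {p : ℝ × ℝ} (h : p.1 ∈ Set.Icc (0 : ℝ) 1) :
    polarMap p ∈ unitDisk := by
  rw [unitDisk, mem_closedBall_zero_iff, norm_polarMap, abs_of_nonneg h.1]
  exact h.2

theorem setIntegral_unitDisk_eq_polar (f : ℂ → ℝ) :
    ∫ z in unitDisk, f z =
      ∫ p in Set.Icc ((0 : ℝ), -Real.pi) (1, Real.pi), p.1 * f (polarMap p) := by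
  rw [← integral_indicator measurableSet_closedBall, ← Complex.integral_comp_polarCoord_symm]
  have h1 : ∀ p ∈ polarCoord.target,
      p.1 • (unitDisk.indicator f) (Complex.polarCoord.symm p) =
        (Set.Iic (1 : ℝ) ×ˢ Set.univ).indicator (fun p => p.1 * f (polarMap p)) p := by
    rintro p ⟨hp, -⟩
    have hp' : (0 : ℝ) < p.1 := hp
    rw [polarMap_eq]
    by_cases h : p.1 ≤ 1
    · rw [Set.indicator_of_mem (polarMap_mem_unitDisk ⟨hp'.le, h⟩),
        Set.indicator_of_mem (by simpa using h), smul_eq_mul]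
    · rw [Set.indicator_of_notMem, Set.indicator_of_notMem (by simpa using h), smul_zero]
      rw [unitDisk, mem_closedBall_zero_iff, norm_polarMap, abs_of_pos hp']
      exact h
  rw [setIntegral_congr_fun polarCoord.open_target.measurableSet h1,
    setIntegral_indicator (measurableSet_Iic.prod MeasurableSet.univ)]
  apply setIntegral_congr_set
  rw [polarCoord_target, Set.prod_inter_prod, Set.inter_univ, ← Set.Icc_prod_Icc]
  exact Measure.set_prod_ae_eq Ioc_ae_eq_Icc Ioo_ae_eq_Icc

/-- Stokes on the disk, obtained from the divergence theorem on the rectangle `[0, 1] × [-π, π]` of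
polar coordinates. Differentiability is needed only in the interior, so a form smooth up to the
boundary is regular enough. -/
theorem integral_diskExtDeriv {β : ℂ → ℂ →L[ℝ] ℝ} (hβ : ContDiffOn ℝ ∞ β unitDisk) :
    ∫ z in unitDisk, diskExtDeriv β z = circleForm β := by
  rw [setIntegral_unitDisk_eq_polar]
  let B : ℝ × ℝ → ℂ →L[ℝ] ℂ →L[ℝ] ℝ := fun p => fderivWithin ℝ β unitDisk (polarMap p)
  let M' : ℝ × ℝ → ℝ × ℝ →L[ℝ] ℂ := fun p =>
    (ContinuousLinearMap.fst ℝ ℝ ℝ).smulRight (Circle.exp p.2 : ℂ) +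
      (ContinuousLinearMap.snd ℝ ℝ ℝ).smulRight (Complex.I * polarMap p)
  let N' : ℝ × ℝ → ℝ × ℝ →L[ℝ] ℂ := fun p => Complex.I • M' p
  let V' : ℝ × ℝ → ℝ × ℝ →L[ℝ] ℂ := fun p =>
    -(ContinuousLinearMap.snd ℝ ℝ ℝ).smulRight (Complex.I * Circle.exp p.2)
  -- The pull-back of `β` to polar coordinates is `f dθ - g dr`, so that `∂f/∂r + ∂g/∂θ` is the
  -- coefficient of its exterior derivative.
  let f : ℝ × ℝ → ℝ := fun p => β (polarMap p) (Complex.I • polarMap p)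
  let g : ℝ × ℝ → ℝ := fun p => β (polarMap p) (-(Circle.exp p.2 : ℂ))
  let f' : ℝ × ℝ → ℝ × ℝ →L[ℝ] ℝ := fun p =>
    (β (polarMap p)).comp (N' p) + ((B p).comp (M' p)).flip (Complex.I • polarMap p)
  let g' : ℝ × ℝ → ℝ × ℝ →L[ℝ] ℝ := fun p =>
    (β (polarMap p)).comp (V' p) + ((B p).comp (M' p)).flip (-(Circle.exp p.2 : ℂ))
  -- The terms with `β` itself cancel, since the mixed partial derivatives of the polar map agree.
  -- What remains is the alternating part of the derivative of `β` on the frame `(exp(iθ), i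
  -- exp(iθ))`, times the Jacobian `r`.
  have key : ∀ p, f' p (1, 0) + g' p (0, 1) = p.1 * diskExtDeriv β (polarMap p) := by
    intro p
    have hs := clm_sub_swap_eq_stdSymplectic_mul (B p) (Circle.exp p.2 : ℂ)
      (Complex.I * Circle.exp p.2)
    rw [Circle.stdSymplectic_I_mul, one_mul] at hs
    have hM : Complex.I * polarMap p = p.1 • (Complex.I * Circle.exp p.2) := by
      rw [polarMap, Complex.real_smul]; ring
    simp only [f', g', N', V', M', add_apply, ContinuousLinearMap.comp_apply,
      ContinuousLinearMap.flip_apply, ContinuousLinearMap.smulRight_apply,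
      smul_apply, neg_apply,
      ContinuousLinearMap.coe_fst', ContinuousLinearMap.coe_snd', one_smul, zero_smul, add_zero,
      zero_add, map_neg, smul_eq_mul, hM, map_smul]
    rw [diskExtDeriv, ← hs]
    ring
  have hmap : Set.MapsTo polarMap (Set.Icc ((0 : ℝ), -Real.pi) (1, Real.pi)) unitDisk := by
    rintro p hp
    rw [← Set.Icc_prod_Icc] at hp
    exact polarMap_mem_unitDisk hp.1
  have hβc : ContinuousOn (fun p => β (polarMap p)) (Set.Icc ((0 : ℝ), -Real.pi) (1, Real.pi)) :=
    hβ.continuousOn.comp continuous_polarMap.continuousOn hmap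
  have hd : ∀ p ∈ Set.Ioo (0 : ℝ) 1 ×ˢ Set.Ioo (-Real.pi) Real.pi,
      HasFDerivAt (fun p => β (polarMap p)) ((B p).comp (M' p)) p := by
    rintro p ⟨hp, -⟩
    have hn : unitDisk ∈ nhds (polarMap p) := by
      refine Filter.mem_of_superset (Metric.isOpen_ball.mem_nhds ?_) Metric.ball_subset_closedBall
      rw [mem_ball_zero_iff, norm_polarMap, abs_of_pos hp.1]
      exact hp.2
    have h1 : HasFDerivAt β (B p) (polarMap p) :=
      ((hβ.differentiableOn (by simp) _ (mem_of_mem_nhds hn)).hasFDerivWithinAt).hasFDerivAt hn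
    exact h1.comp p (hasFDerivAt_polarMap p)
  have hdiv := integral_divergence_prod_Icc_of_hasFDerivAt_of_le f g f' g'
    ((0 : ℝ), -Real.pi) (1, Real.pi) ⟨zero_le_one, by linarith [Real.pi_pos]⟩
    (hβc.clm_apply (continuous_polarMap.const_smul Complex.I).continuousOn)
    (hβc.clm_apply (by fun_prop))
    (fun p hp => (hd p hp).clm_apply ((hasFDerivAt_polarMap p).const_smul Complex.I))
    (fun p hp => (hd p hp).clm_apply (hasFDerivAt_circleExp_snd p).neg)
    (by
      simp only [key]
      refine ContinuousOn.integrableOn_compact isCompact_Icc ?_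
      exact continuousOn_fst.mul
        ((continuousOn_diskExtDeriv hβ).comp continuous_polarMap.continuousOn hmap))
  simp only [key] at hdiv
  rw [hdiv]
  -- Only the edge `r = 1` contributes: `f` vanishes on `r = 0`, and the edges `θ = ±π` carry the
  -- same values of `g` with opposite signs.
  simp [f, g, polarMap, circleForm]

theorem integral_wedge_fderivWithin_add {f : ℂ → ℝ} {β : ℂ → ℂ →L[ℝ] ℝ}
    (hf : ContDiffOn ℝ ∞ f unitDisk) (hβ : ContDiffOn ℝ ∞ β unitDisk) :
    (∫ z in unitDisk, wedge (fderivWithin ℝ f unitDisk z) (β z) 1 Complex.I) +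
      ∫ z in unitDisk, f z * diskExtDeriv β z = circleForm (fun z => f z • β z) := by
  rw [← integral_diskExtDeriv (β := fun z => f z • β z) (hf.smul hβ), ← integral_add]
  · refine setIntegral_congr_fun measurableSet_closedBall fun z hz => ?_
    have hu := uniqueDiffOn_unitDisk z hz
    dsimp only [diskExtDeriv]
    rw [fderivWithin_fun_smul hu (hf.differentiableOn (by simp) z hz)
      (hβ.differentiableOn (by simp) z hz)]
    simp [wedge]
    ring
  · apply ContinuousOn.integrableOn_unitDisk
    have h1 := hf.continuousOn_fderivWithin uniqueDiffOn_unitDisk (by simp)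
    have h2 := hβ.continuousOn
    exact ((h1.clm_apply continuousOn_const).mul (h2.clm_apply continuousOn_const)).sub
      ((h1.clm_apply continuousOn_const).mul (h2.clm_apply continuousOn_const))
  · exact (hf.continuousOn.mul (continuousOn_diskExtDeriv hβ)).integrableOn_unitDisk

/-! ### Symplectomorphisms acting on forms, and the Calabi invariant -/

theorem ContinuousLinearMap.det_eq_stdSymplectic (L : ℂ →L[ℝ] ℂ) :
    L.det = stdSymplectic (L 1) (L Complex.I) := by
  rw [ContinuousLinearMap.det, ← LinearMap.det_toMatrix Complex.basisOneI, Matrix.det_fin_two]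
  simp [LinearMap.toMatrix_apply, stdSymplectic]
  ring

namespace SympDisk

theorem contDiffOn (g : SympDisk) : ContDiffOn ℝ ∞ (diskFun g.1) unitDisk := g.2.1

theorem hasFDerivWithinAt (g : SympDisk) {z : ℂ} (hz : z ∈ unitDisk) :
    HasFDerivWithinAt (diskFun g.1) (fderivWithin ℝ (diskFun g.1) unitDisk z) unitDisk z :=
  ((contDiffOn g).differentiableOn (by simp) z hz).hasFDerivWithinAt

theorem stdSymplectic_fderivWithin (g : SympDisk) {z : ℂ} (hz : z ∈ unitDisk) (u v : ℂ) :
    stdSymplectic (fderivWithin ℝ (diskFun g.1) unitDisk z u)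
      (fderivWithin ℝ (diskFun g.1) unitDisk z v) = stdSymplectic u v := g.2.2.2 z hz u v

theorem integral_comp (g : SympDisk) (φ : ℂ → ℝ) :
    ∫ z in unitDisk, φ (diskFun g.1 z) = ∫ z in unitDisk, φ z := by
  have himage : diskFun g.1 '' unitDisk = unitDisk := by
    refine Set.Subset.antisymm (mapsTo_diskFun g.1).image_subset fun w hw => ?_
    refine ⟨diskFun g⁻¹.1 w, mapsTo_diskFun _ hw, ?_⟩
    have h : diskFun (g.1 * g⁻¹.1) w = w := by
      rw [show g.1 * g⁻¹.1 = 1 from mul_inv_cancel g.1, diskFun_one]; rfl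
    rwa [diskFun_mul] at h
  have hinj : Set.InjOn (diskFun g.1) unitDisk := by
    intro z hz w hw h
    rw [diskFun_of_mem _ hz, diskFun_of_mem _ hw] at h
    exact congrArg Subtype.val (g.1.injective (Subtype.ext h))
  have h := integral_image_eq_integral_abs_det_fderiv_smul volume measurableSet_closedBall
    (fun z hz => hasFDerivWithinAt g hz) hinj φ
  rw [himage] at h
  rw [h]
  refine setIntegral_congr_fun measurableSet_closedBall fun z hz => ?_
  rw [ContinuousLinearMap.det_eq_stdSymplectic, stdSymplectic_fderivWithin g hz]
  simp [stdSymplectic]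

end SympDisk

theorem pullback_mul (g h : SympDisk) (η : ℂ → ℂ →L[ℝ] ℝ) {z : ℂ} (hz : z ∈ unitDisk) :
    pullback (g.1 * h.1) η z = pullback h.1 (pullback g.1 η) z := by
  have hc := (SympDisk.hasFDerivWithinAt g (mapsTo_diskFun h.1 hz)).comp z
    (SympDisk.hasFDerivWithinAt h hz) (mapsTo_diskFun h.1)
  rw [pullback, diskFun_mul, hc.fderivWithin (uniqueDiffOn_unitDisk z hz)]
  rfl

/-- At each point `α ∧ β` is a multiple of `ω`, which `g` preserves. -/
theorem wedge_pullback (g : SympDisk) (α β : ℂ → ℂ →L[ℝ] ℝ) {z : ℂ} (hz : z ∈ unitDisk) :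
    wedge (pullback g.1 α z) (pullback g.1 β z) 1 Complex.I =
      wedge (α (diskFun g.1 z)) (β (diskFun g.1 z)) 1 Complex.I := by
  have h := wedge_map_eq_stdSymplectic_mul (α (diskFun g.1 z)) (β (diskFun g.1 z))
    (fderivWithin ℝ (diskFun g.1) unitDisk z 1) (fderivWithin ℝ (diskFun g.1) unitDisk z Complex.I)
  rw [SympDisk.stdSymplectic_fderivWithin g hz,
    show stdSymplectic 1 Complex.I = 1 by simp [stdSymplectic], one_mul] at h
  exact h

theorem contDiffOn_pullback (g : SympDisk) {η : ℂ → ℂ →L[ℝ] ℝ} (hη : ContDiffOn ℝ ∞ η unitDisk) :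
    ContDiffOn ℝ ∞ (pullback g.1 η) unitDisk :=
  (hη.comp (SympDisk.contDiffOn g) (mapsTo_diskFun g.1)).clm_comp
    ((SympDisk.contDiffOn g).fderivWithin uniqueDiffOn_unitDisk (by simp))

/-- The exterior derivative commutes with pull-back: differentiating `g^*η` produces a term with the
second derivative of `g`, which is symmetric and drops out on antisymmetrizing. -/
theorem IsPrimitive.pullback {η : ℂ → ℂ →L[ℝ] ℝ} (hη : IsPrimitive η) (g : SympDisk) :
    IsPrimitive (pullback g.1 η) := by
  refine ⟨contDiffOn_pullback g hη.1, fun z hz u v => ?_⟩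
  have hu := uniqueDiffOn_unitDisk z hz
  have h1 : HasFDerivWithinAt (fun z => η (diskFun g.1 z))
      ((fderivWithin ℝ η unitDisk (diskFun g.1 z)).comp
        (fderivWithin ℝ (diskFun g.1) unitDisk z)) unitDisk z :=
    ((hη.1.differentiableOn (by simp) _ (mapsTo_diskFun g.1 hz)).hasFDerivWithinAt).comp z
      (SympDisk.hasFDerivWithinAt g hz) (mapsTo_diskFun g.1)
  have h2 := (((SympDisk.contDiffOn g).fderivWithin uniqueDiffOn_unitDisk (m := ∞)
    (by simp)).differentiableOn (by simp) z hz).hasFDerivWithinAt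
  have h3 := h1.clm_comp h2
  -- The symmetry persists at boundary points because the disk is the closure of its interior.
  have hsymm : IsSymmSndFDerivWithinAt ℝ (diskFun g.1) unitDisk z := by
    refine ((SympDisk.contDiffOn g) z hz).isSymmSndFDerivWithinAt (n := ∞)
      (by simpa using WithTop.coe_le_coe.2 (le_top (a := (2 : ℕ∞))))
      uniqueDiffOn_unitDisk ?_ hz
    rw [interior_closedBall 0 one_ne_zero, closure_ball 0 one_ne_zero]
    exact hz
  have hd := hη.2 (diskFun g.1 z) (mapsTo_diskFun g.1 hz)
    (fderivWithin ℝ (diskFun g.1) unitDisk z u) (fderivWithin ℝ (diskFun g.1) unitDisk z v)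
  rw [SympDisk.stdSymplectic_fderivWithin g hz] at hd
  have h4 : fderivWithin ℝ (_root_.pullback g.1 η) unitDisk z = _ := h3.fderivWithin hu
  rw [h4, ← hd]
  have h5 := hsymm u v
  simp [h5]

theorem IsPrimitive.diskExtDeriv_eq_one {η : ℂ → ℂ →L[ℝ] ℝ} (hη : IsPrimitive η) {z : ℂ}
    (hz : z ∈ unitDisk) : diskExtDeriv η z = 1 := by
  rw [diskExtDeriv, hη.2 z hz]
  simp [stdSymplectic]

/-- The Poincaré lemma on a convex set: the difference of two primitives of `ω` is closed, hence
exact. The potential is smooth because its derivative is. -/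
theorem IsPrimitive.exists_fderivWithin_eq_sub {η η' : ℂ → ℂ →L[ℝ] ℝ} (hη : IsPrimitive η)
    (hη' : IsPrimitive η') : ∃ f : ℂ → ℝ, ContDiffOn ℝ ∞ f unitDisk ∧
      ∀ z ∈ unitDisk, HasFDerivWithinAt f (η z - η' z) unitDisk z := by
  have hω : DifferentiableOn ℝ (fun z => η z - η' z) unitDisk :=
    (hη.1.sub hη'.1).differentiableOn (by simp)
  obtain ⟨f, hf⟩ := (convex_closedBall (0 : ℂ) 1).exists_forall_hasFDerivWithinAt_of_fderivWithin_symmetric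
    hω (by
      intro z hz u _ v _
      rw [fderivWithin_fun_sub (uniqueDiffOn_unitDisk z hz) (hη.1.differentiableOn (by simp) z hz)
        (hη'.1.differentiableOn (by simp) z hz)]
      have h1 := hη.2 z hz u v
      have h2 := hη'.2 z hz u v
      simp only [sub_apply]
      linarith)
  refine ⟨f, ?_, hf⟩
  rw [contDiffOn_infty_iff_fderivWithin uniqueDiffOn_unitDisk]
  refine ⟨fun z hz => (hf z hz).differentiableWithinAt, ?_⟩
  exact (hη.1.sub hη'.1).congr fun z hz => (hf z hz).fderivWithin (uniqueDiffOn_unitDisk z hz)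

theorem continuousOn_wedge {α β : ℂ → ℂ →L[ℝ] ℝ} (hα : ContDiffOn ℝ ∞ α unitDisk)
    (hβ : ContDiffOn ℝ ∞ β unitDisk) :
    ContinuousOn (fun z => wedge (α z) (β z) 1 Complex.I) unitDisk :=
  ((hα.continuousOn.clm_apply continuousOn_const).mul
    (hβ.continuousOn.clm_apply continuousOn_const)).sub
  ((hα.continuousOn.clm_apply continuousOn_const).mul
    (hβ.continuousOn.clm_apply continuousOn_const))

/-- Stokes' theorem for `df ∧ β`, where `df` is the difference of two primitives of `ω`. -/
theorem integral_wedge_sub {η η' β : ℂ → ℂ →L[ℝ] ℝ} {f : ℂ → ℝ} (hf : ContDiffOn ℝ ∞ f unitDisk)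
    (hd : ∀ z ∈ unitDisk, HasFDerivWithinAt f (η z - η' z) unitDisk z)
    (hβ : ContDiffOn ℝ ∞ β unitDisk) :
    ∫ z in unitDisk, wedge (η z - η' z) (β z) 1 Complex.I =
      circleForm (fun z => f z • β z) - ∫ z in unitDisk, f z * diskExtDeriv β z := by
  rw [← integral_wedge_fderivWithin_add hf hβ, add_sub_cancel_right]
  refine setIntegral_congr_fun measurableSet_closedBall fun z hz => ?_
  rw [(hd z hz).fderivWithin (uniqueDiffOn_unitDisk z hz)]

/-- Area preservation by `h` rewrites `∫ η ∧ g^*η` as `∫ h^*η ∧ h^*g^*η`. The three terms then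
assemble by bilinearity, since `h^*η ∧ h^*η = 0`. -/
theorem calabi_coboundary {η : ℂ → ℂ →L[ℝ] ℝ} (hη : IsPrimitive η) (g h : SympDisk) :
    calabi η h.1 - calabi η (g.1 * h.1) + calabi η g.1 =
      -∫ z in unitDisk, wedge (η z - pullback h.1 η z)
        (pullback h.1 η z - pullback h.1 (pullback g.1 η) z) 1 Complex.I := by
  have hh := (hη.pullback h).1
  have hgh := ((hη.pullback g).pullback h).1
  have e1 : calabi η (g.1 * h.1) =
      -∫ z in unitDisk, wedge (η z) (pullback h.1 (pullback g.1 η) z) 1 Complex.I := by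
    rw [calabi]
    congr 1
    refine setIntegral_congr_fun measurableSet_closedBall fun z hz => ?_
    rw [pullback_mul g h η hz]
  have e2 : calabi η g.1 = -∫ z in unitDisk,
      wedge (pullback h.1 η z) (pullback h.1 (pullback g.1 η) z) 1 Complex.I := by
    rw [calabi, ← SympDisk.integral_comp h]
    congr 1
    refine setIntegral_congr_fun measurableSet_closedBall fun z hz => ?_
    exact (wedge_pullback h η (pullback g.1 η) hz).symm
  rw [e1, e2, calabi, ← sub_eq_zero]
  have i1 := (continuousOn_wedge hη.1 hh).integrableOn_unitDisk
  have i2 := (continuousOn_wedge hη.1 hgh).integrableOn_unitDisk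
  have i3 := (continuousOn_wedge hh hgh).integrableOn_unitDisk
  have e3 : ∫ z in unitDisk, wedge (η z - pullback h.1 η z)
        (pullback h.1 η z - pullback h.1 (pullback g.1 η) z) 1 Complex.I =
      ∫ z in unitDisk, (wedge (η z) (pullback h.1 η z) 1 Complex.I -
        wedge (η z) (pullback h.1 (pullback g.1 η) z) 1 Complex.I +
        wedge (pullback h.1 η z) (pullback h.1 (pullback g.1 η) z) 1 Complex.I) := by
    congr 1
    funext z
    simp only [wedge, sub_apply]
    ring
  have e4 := integral_add (i1.sub i2) i3
  simp only [Pi.sub_apply] at e4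
  rw [e3, e4, integral_sub i1 i2]
  ring

theorem hasDerivAt_diskFun_exp (g : SympDisk) (t : ℝ) :
    HasDerivAt (fun t => diskFun g.1 (Circle.exp t))
      (fderivWithin ℝ (diskFun g.1) unitDisk (Circle.exp t) (Complex.I * Circle.exp t)) t := by
  have h := (SympDisk.hasFDerivWithinAt g (circle_mem_unitDisk (Circle.exp t))).comp_hasDerivWithinAt
    (s := Set.univ) t
    (Circle.hasDerivAt_coe_exp t).hasDerivWithinAt (fun s _ => circle_mem_unitDisk (Circle.exp s))
  exact h.hasDerivAt Filter.univ_mem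

theorem hasDerivAt_comp_exp {f : ℂ → ℝ} {κ : ℂ → ℂ →L[ℝ] ℝ}
    (hd : ∀ z ∈ unitDisk, HasFDerivWithinAt f (κ z) unitDisk z) (t : ℝ) :
    HasDerivAt (fun t => f (Circle.exp t)) (κ (Circle.exp t) (Complex.I * Circle.exp t)) t := by
  have h := (hd _ (circle_mem_unitDisk (Circle.exp t))).comp_hasDerivWithinAt
    (s := Set.univ) t
    (Circle.hasDerivAt_coe_exp t).hasDerivWithinAt (fun s _ => circle_mem_unitDisk (Circle.exp s))
  exact h.hasDerivAt Filter.univ_mem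

theorem continuous_circleForm_integrand {β : ℂ → ℂ →L[ℝ] ℝ} (hβ : ContDiffOn ℝ ∞ β unitDisk) :
    Continuous fun t : ℝ => β (Circle.exp t) (Complex.I * Circle.exp t) := by
  have h : Continuous fun t : ℝ => β (Circle.exp t) :=
    hβ.continuousOn.comp_continuous (by fun_prop) fun t => circle_mem_unitDisk _
  exact h.clm_apply (by fun_prop)

theorem Circle.exp_pi_eq_exp_neg_pi : Circle.exp Real.pi = Circle.exp (-Real.pi) := by
  rw [← Circle.exp_add_two_pi (-Real.pi)]
  ring_nf

/-- The Calabi integral of a map which fixes the boundary does not depend on the primitive. -/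
theorem calabi_eq_of_isPrimitive {η η' : ℂ → ℂ →L[ℝ] ℝ} (hη : IsPrimitive η)
    (hη' : IsPrimitive η') (h : SympDiskRel) : calabi η h.1.1 = calabi η' h.1.1 := by
  obtain ⟨f, hf, hd⟩ := hη.exists_fderivWithin_eq_sub hη'
  have hb : ∀ t : ℝ, diskFun h.1.1 (Circle.exp t) = Circle.exp t := fun t => by
    rw [diskFun_of_mem _ (circle_mem_unitDisk _)]
    exact congrArg Subtype.val (h.2 ⟨_, circle_mem_unitDisk (Circle.exp t)⟩ (Circle.norm_coe _))
  -- Only the tangential derivative of `h` on the boundary is controlled; the normal one may be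
  -- arbitrary, but boundary integrals do not see it.
  have hdb : ∀ t : ℝ, fderivWithin ℝ (diskFun h.1.1) unitDisk (Circle.exp t)
      (Complex.I * Circle.exp t) = Complex.I * Circle.exp t := fun t => by
    refine (hasDerivAt_diskFun_exp h.1 t).unique ?_
    simp only [hb]
    exact Circle.hasDerivAt_coe_exp t
  have hp := hη.pullback h.1
  have hp' := hη'.pullback h.1
  have hfh := hf.comp (SympDisk.contDiffOn h.1) (mapsTo_diskFun h.1.1)
  have hdh : ∀ z ∈ unitDisk, HasFDerivWithinAt (f ∘ diskFun h.1.1)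
      (pullback h.1.1 η z - pullback h.1.1 η' z) unitDisk z := by
    intro z hz
    refine ((hd _ (mapsTo_diskFun h.1.1 hz)).comp z (SympDisk.hasFDerivWithinAt h.1 hz)
      (mapsTo_diskFun h.1.1)).congr_fderiv ?_
    ext
    simp [pullback]
  have s1 := integral_wedge_sub hf hd hp.1
  have s2 := integral_wedge_sub hfh hdh hη'.1
  -- Both pulled-back and original primitives have exterior derivative `ω`, so the area terms are `∫
  -- f ω` and `∫ (f ∘ h) ω`, equal because `h` preserves area.
  have s3 : ∫ z in unitDisk, f z * diskExtDeriv (pullback h.1.1 η) z =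
      ∫ z in unitDisk, (f ∘ diskFun h.1.1) z * diskExtDeriv η' z := by
    have a1 : ∫ z in unitDisk, f z * diskExtDeriv (pullback h.1.1 η) z =
        ∫ z in unitDisk, f z :=
      setIntegral_congr_fun measurableSet_closedBall fun z hz => by
        simp only [hp.diskExtDeriv_eq_one hz, mul_one]
    have a2 : ∫ z in unitDisk, (f ∘ diskFun h.1.1) z * diskExtDeriv η' z =
        ∫ z in unitDisk, f (diskFun h.1.1 z) :=
      setIntegral_congr_fun measurableSet_closedBall fun z hz => by
        simp only [hη'.diskExtDeriv_eq_one hz, mul_one, Function.comp_apply]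
    rw [a1, a2, SympDisk.integral_comp]
  -- With `h` the identity on the circle, the difference of the boundary terms is `∮ f (η - η') = ∮
  -- f df`, the integral of the exact form `d(f² / 2)`.
  have s4 : circleForm (fun z => f z • pullback h.1.1 η z) =
      circleForm (fun z => (f ∘ diskFun h.1.1) z • η' z) := by
    have c1 : Continuous fun t : ℝ => f (Circle.exp t) :=
      hf.continuousOn.comp_continuous (by fun_prop) fun t => circle_mem_unitDisk _
    have c2 := continuous_circleForm_integrand hη.1
    have c3 := continuous_circleForm_integrand hη'.1
    rw [← sub_eq_zero, circleForm, circleForm, ← intervalIntegral.integral_sub]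
    · have hF : ∀ t : ℝ, HasDerivAt (fun t : ℝ => f (Circle.exp t) ^ 2 / 2)
          ((f (Circle.exp t) • pullback h.1.1 η (Circle.exp t)) (Complex.I * Circle.exp t) -
            ((f ∘ diskFun h.1.1) (Circle.exp t) • η' (Circle.exp t))
              (Complex.I * Circle.exp t)) t := by
        intro t
        have := ((hasDerivAt_comp_exp hd t).pow 2).div_const 2
        refine this.congr_deriv ?_
        simp only [smul_apply, smul_eq_mul, Function.comp_apply, hb, pullback,
          ContinuousLinearMap.comp_apply, hdb, sub_apply]
        push_cast
        ring
      rw [intervalIntegral.integral_eq_sub_of_hasDerivAt (fun t _ => hF t),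
        Circle.exp_pi_eq_exp_neg_pi, sub_self]
      refine Continuous.intervalIntegrable ?_ _ _
      simp only [smul_apply, smul_eq_mul, Function.comp_apply, hb, pullback,
          ContinuousLinearMap.comp_apply, hdb]
      exact (c1.mul c2).sub (c1.mul c3)
    · refine Continuous.intervalIntegrable ?_ _ _
      simp only [smul_apply, smul_eq_mul, hb, pullback, ContinuousLinearMap.comp_apply, hdb]
      exact c1.mul c2
    · refine Continuous.intervalIntegrable ?_ _ _
      simp only [smul_apply, smul_eq_mul, Function.comp_apply, hb]
      exact c1.mul c3
  rw [calabi, calabi, neg_inj, ← sub_eq_zero,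
    ← integral_sub (continuousOn_wedge hη.1 hp.1).integrableOn_unitDisk
      (continuousOn_wedge hη'.1 hp'.1).integrableOn_unitDisk]
  -- The identity `η ∧ h^*η - η' ∧ h^*η' = df ∧ h^*η - d(f ∘ h) ∧ η'`, where each right-hand term
  -- has an exact factor and Stokes applies.
  have e : ∀ z, wedge (η z) (pullback h.1.1 η z) 1 Complex.I -
      wedge (η' z) (pullback h.1.1 η' z) 1 Complex.I =
      wedge (η z - η' z) (pullback h.1.1 η z) 1 Complex.I -
        wedge (pullback h.1.1 η z - pullback h.1.1 η' z) (η' z) 1 Complex.I := fun z => by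
    simp only [wedge, sub_apply]
    ring
  simp only [e]
  rw [integral_sub (continuousOn_wedge (hη.1.sub hη'.1) hp.1).integrableOn_unitDisk
    (continuousOn_wedge (hp.1.sub hp'.1) hη'.1).integrableOn_unitDisk, s1, s2, s3, s4]
  ring

/-! ### The coboundary of the Calabi integral in terms of lifts of the boundary maps -/

namespace DiffCircleCover

/-- A quarter of the integral of a lift over a period. -/
def quarterIntegral (F : DiffCircleCover) : ℝ :=
  (1 / 4) * ∫ t in -Real.pi..Real.pi, F.1 t

/-- Integrating over a period centred at `0` is what normalizes the identity lift to `0`. -/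
theorem quarterIntegral_one : quarterIntegral 1 = 0 := by
  have : ∫ t in -Real.pi..Real.pi, (1 : DiffCircleCover).1 t = ∫ t in -Real.pi..Real.pi, t := rfl
  rw [quarterIntegral, this, integral_id]
  ring

/-- This is where the factor `π²` of the main theorem arises: `(1/4) · 2π · 2πn`. -/
theorem quarterIntegral_translation_mul (n : ℤ) (F : DiffCircleCover) :
    quarterIntegral (translation (Multiplicative.ofAdd n) * F) =
      quarterIntegral F + Real.pi ^ 2 * n := by
  have h : ∀ t, (translation (Multiplicative.ofAdd n) * F).1 t = F.1 t + 2 * Real.pi * n :=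
    fun t => rfl
  simp only [quarterIntegral, h]
  rw [intervalIntegral.integral_add (F.1.continuous.intervalIntegrable _ _)
    (continuous_const.intervalIntegrable _ _), intervalIntegral.integral_const, smul_eq_mul]
  ring

theorem hasDerivAt (F : DiffCircleCover) (t : ℝ) : HasDerivAt F.1 (deriv F.1 t) t :=
  ((contDiff F).differentiable (by simp) t).hasDerivAt

theorem continuous_deriv (F : DiffCircleCover) : Continuous (deriv F.1) :=
  (contDiff F).continuous_deriv (by simp)

theorem map_pi (F : DiffCircleCover) : F.1 Real.pi = F.1 (-Real.pi) + 2 * Real.pi := by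
  rw [← map_add_two_pi]
  ring_nf

/-- Substituting `u = H(t)` gives the integral of `u - G(u)` over a period starting at `H(-π)`. This
function is periodic, so the period may be moved back to `[-π, π]`, where `u` integrates to zero. -/
theorem integral_sub_comp_mul_deriv (G H : DiffCircleCover) :
    ∫ t in -Real.pi..Real.pi, (H.1 t - G.1 (H.1 t)) * deriv H.1 t =
      -∫ t in -Real.pi..Real.pi, G.1 t := by
  have hc : Continuous fun u => u - G.1 u := continuous_id.sub G.1.continuous
  have h1 := intervalIntegral.integral_comp_mul_deriv (a := -Real.pi) (b := Real.pi)
    (g := fun u => u - G.1 u) (fun t _ => hasDerivAt H t) (continuous_deriv H).continuousOn hc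
  have hp : Function.Periodic (fun u => u - G.1 u) (2 * Real.pi) := fun u => by
    simp only [map_add_two_pi]; ring
  have h2 := hp.intervalIntegral_add_eq (H.1 (-Real.pi)) (-Real.pi)
  rw [← map_pi, show -Real.pi + 2 * Real.pi = Real.pi by ring] at h2
  refine h1.trans (h2.trans ?_)
  rw [intervalIntegral.integral_sub (f := fun u => u) (continuous_id.intervalIntegrable _ _)
      (G.1.continuous.intervalIntegrable _ _), integral_id]
  ring

end DiffCircleCover

/-- `F` is a lift of the restriction of `g` to the boundary circle. -/
def IsBoundaryLift (g : SympDisk) (F : DiffCircleCover) : Prop :=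
  ∀ t : ℝ, diskFun g.1 (Circle.exp t) = Circle.exp (F.1 t)

theorem IsBoundaryLift.pullback_apply {g : SympDisk} {F : DiffCircleCover}
    (h : IsBoundaryLift g F) (α : ℂ → ℂ →L[ℝ] ℝ) (t : ℝ) :
    pullback g.1 α (Circle.exp t) (Complex.I * Circle.exp t) =
      deriv F.1 t * α (Circle.exp (F.1 t)) (Complex.I * Circle.exp (F.1 t)) := by
  have h1 : fderivWithin ℝ (diskFun g.1) unitDisk (Circle.exp t) (Complex.I * Circle.exp t) =
      deriv F.1 t • (Complex.I * Circle.exp (F.1 t)) := by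
    refine (hasDerivAt_diskFun_exp g t).unique ?_
    simp only [h _]
    exact (Circle.hasDerivAt_coe_exp (F.1 t)).scomp t (DiffCircleCover.hasDerivAt F t)
  rw [pullback, ContinuousLinearMap.comp_apply, h1, h t, map_smul, smul_eq_mul]

theorem stdPrimitive_circle (z : Circle) : stdPrimitive z (Complex.I * z) = 1 / 2 := by
  have h := z.stdSymplectic_I_mul
  rw [stdSymplectic] at h
  simp only [stdPrimitive, smul_apply, sub_apply, Complex.imCLM_apply, Complex.reCLM_apply,
    smul_eq_mul, h, mul_one]

/-- Write `η - h^*η = df`. On the circle the second factor is the differential of `v = (H - G ∘ H) /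
2`, so Stokes gives `-∮ f dv = ∮ v df` with `df = (1 - H') / 2 dt`. Expanding the product leaves
`(1/4) ∫ (H - G ∘ H)` minus the integral computed by `integral_sub_comp_mul_deriv`. -/
theorem calabi_coboundary_eq {g h : SympDisk} {G H : DiffCircleCover}
    (hG : IsBoundaryLift g G) (hH : IsBoundaryLift h H) :
    calabi stdPrimitive h.1 - calabi stdPrimitive (g.1 * h.1) + calabi stdPrimitive g.1 =
      DiffCircleCover.quarterIntegral H - DiffCircleCover.quarterIntegral (G * H) +
        DiffCircleCover.quarterIntegral G := by
  have hη := isPrimitive_stdPrimitive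
  have hη' := hη.pullback h
  have hη'' := (hη.pullback g).pullback h
  obtain ⟨f, hf, hd⟩ := hη.exists_fderivWithin_eq_sub hη'
  rw [calabi_coboundary hη, integral_wedge_sub hf hd (hη'.1.sub hη''.1)]
  -- The second factor is a difference of two primitives of `ω`, hence closed.
  have hzero : ∫ z in unitDisk, f z * diskExtDeriv
      (fun z => pullback h.1 stdPrimitive z - pullback h.1 (pullback g.1 stdPrimitive) z) z = 0 := by
    rw [setIntegral_congr_fun (g := fun _ => (0 : ℝ)) measurableSet_closedBall, integral_zero]
    intro z hz
    have e := hη'.diskExtDeriv_eq_one hz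
    have e' := hη''.diskExtDeriv_eq_one hz
    dsimp only [diskExtDeriv] at e e' ⊢
    rw [fderivWithin_fun_sub (uniqueDiffOn_unitDisk z hz) (hη'.1.differentiableOn (by simp) z hz)
        (hη''.1.differentiableOn (by simp) z hz)]
    simp only [sub_apply]
    rw [sub_sub_sub_comm, e, e', sub_self, mul_zero]
  rw [hzero, sub_zero, circleForm]
  have hu : ∀ t : ℝ, HasDerivAt (fun t => f (Circle.exp t)) ((1 - deriv H.1 t) / 2) t := by
    intro t
    refine (hasDerivAt_comp_exp hd t).congr_deriv ?_
    rw [sub_apply, hH.pullback_apply, stdPrimitive_circle, stdPrimitive_circle]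
    ring
  have hGH : ∀ t, HasDerivAt (fun t => G.1 (H.1 t)) (deriv G.1 (H.1 t) * deriv H.1 t) t :=
    fun t => (DiffCircleCover.hasDerivAt G (H.1 t)).comp t (DiffCircleCover.hasDerivAt H t)
  have hv : ∀ t : ℝ, HasDerivAt (fun t => (H.1 t - G.1 (H.1 t)) / 2)
      ((deriv H.1 t - deriv G.1 (H.1 t) * deriv H.1 t) / 2) t := fun t =>
    ((DiffCircleCover.hasDerivAt H t).sub (hGH t)).div_const 2
  have cH := H.1.continuous
  have cG := G.1.continuous
  have cH' := DiffCircleCover.continuous_deriv H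
  have cG' := DiffCircleCover.continuous_deriv G
  have hint : ∀ t : ℝ, (f (Circle.exp t) • (pullback h.1 stdPrimitive (Circle.exp t) -
      pullback h.1 (pullback g.1 stdPrimitive) (Circle.exp t))) (Complex.I * Circle.exp t) =
      f (Circle.exp t) * ((deriv H.1 t - deriv G.1 (H.1 t) * deriv H.1 t) / 2) := fun t => by
    rw [smul_apply, sub_apply, hH.pullback_apply, hH.pullback_apply, hG.pullback_apply,
      stdPrimitive_circle, stdPrimitive_circle, smul_eq_mul]
    ring
  simp only [hint]
  -- The end-point terms cancel: `f` is a function on the circle, and `H - G ∘ H` is periodic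
  -- although `H` and `G ∘ H` are not.
  rw [intervalIntegral.integral_mul_deriv_eq_deriv_mul (fun t _ => hu t) (fun t _ => hv t)
    (Continuous.intervalIntegrable (by fun_prop) _ _)
    (Continuous.intervalIntegrable (by fun_prop) _ _), Circle.exp_pi_eq_exp_neg_pi,
    DiffCircleCover.map_pi H, DiffCircleCover.map_add_two_pi G]
  have e : ∀ t, (1 - deriv H.1 t) / 2 * ((H.1 t - G.1 (H.1 t)) / 2) =
      (1 / 4) * (H.1 t - G.1 (H.1 t) - (H.1 t - G.1 (H.1 t)) * deriv H.1 t) := fun t => by ring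
  simp only [e]
  rw [intervalIntegral.integral_const_mul, intervalIntegral.integral_sub
    (Continuous.intervalIntegrable (by fun_prop) _ _)
    (Continuous.intervalIntegrable (by fun_prop) _ _), intervalIntegral.integral_sub
    (Continuous.intervalIntegrable (by fun_prop) _ _)
    (Continuous.intervalIntegrable (by fun_prop) _ _),
    DiffCircleCover.integral_sub_comp_mul_deriv]
  have e2 : ∫ t in -Real.pi..Real.pi, (G * H).1 t = ∫ t in -Real.pi..Real.pi, G.1 (H.1 t) := rfl
  simp only [DiffCircleCover.quarterIntegral, e2]
  ring

/-! ### Restriction of symplectomorphisms to the boundary circle -/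

namespace SympDisk

theorem diskFun_inv_apply (g : SympDisk) (z : ℂ) :
    diskFun g⁻¹.1 (diskFun g.1 z) = z := by
  have h : diskFun (g⁻¹.1 * g.1) z = z := by
    rw [show g⁻¹.1 * g.1 = 1 from inv_mul_cancel g.1, diskFun_one]; rfl
  rwa [diskFun_mul] at h

/-- Preserving `ω` forces an invertible derivative, so `g` is open at interior points and sends them
to interior points of the disk. Applied to the inverse, this shows that the boundary is preserved.
-/
theorem norm_diskFun_lt_one (g : SympDisk) {z : ℂ} (hz : ‖z‖ < 1) : ‖diskFun g.1 z‖ < 1 := by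
  have hzD : z ∈ unitDisk := by rw [unitDisk, mem_closedBall_zero_iff]; exact hz.le
  have hn : unitDisk ∈ nhds z :=
    Filter.mem_of_superset (Metric.isOpen_ball.mem_nhds (mem_ball_zero_iff.2 hz))
      Metric.ball_subset_closedBall
  have hs := ((contDiffOn g).contDiffAt hn).hasStrictFDerivAt (by simp)
  have hi : Function.Injective (fderiv ℝ (diskFun g.1) z) := by
    rw [injective_iff_map_eq_zero]
    intro u hu
    have h1 := fun v => stdSymplectic_fderivWithin g hzD u v
    rw [fderivWithin_of_mem_nhds hn, hu] at h1
    have h2 := h1 Complex.I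
    have h3 := h1 1
    simp [stdSymplectic] at h2 h3
    exact Complex.ext h2.symm h3
  have hm := hs.map_nhds_eq_of_surj
    (LinearMap.range_eq_top.2 (LinearMap.injective_iff_surjective.1 hi))
  have h4 : unitDisk ∈ nhds (diskFun g.1 z) := by
    rw [← hm]
    exact Filter.mem_map.2 (Filter.mem_of_superset hn (mapsTo_diskFun g.1))
  have h5 := mem_interior_iff_mem_nhds.2 h4
  rwa [interior_closedBall 0 one_ne_zero, mem_ball_zero_iff] at h5

theorem norm_diskFun_circle (g : SympDisk) (z : Circle) : ‖diskFun g.1 z‖ = 1 := by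
  have hz := circle_mem_unitDisk z
  have h1 : ‖diskFun g.1 z‖ ≤ 1 := mem_closedBall_zero_iff.1 (mapsTo_diskFun g.1 hz)
  refine h1.antisymm (not_lt.1 fun h => ?_)
  have h2 := norm_diskFun_lt_one g⁻¹ h
  rw [diskFun_inv_apply g, Circle.norm_coe] at h2
  exact lt_irrefl _ h2

/-- The restriction of a symplectomorphism to the boundary circle, as a map. -/
def circleFun (g : SympDisk) (z : Circle) : Circle :=
  ⟨diskFun g.1 z, mem_sphere_zero_iff_norm.2 (norm_diskFun_circle g z)⟩

theorem coe_circleFun (g : SympDisk) (z : Circle) : (circleFun g z : ℂ) = diskFun g.1 z := rfl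

/-- The restriction of a symplectomorphism to the boundary circle. -/
def circlePerm (g : SympDisk) : Equiv.Perm Circle where
  toFun := circleFun g
  invFun := circleFun g⁻¹
  left_inv z := Circle.ext (diskFun_inv_apply g z)
  right_inv z := Circle.ext (by
    have := diskFun_inv_apply g⁻¹ z
    rwa [inv_inv] at this)

theorem contDiff_circleFun_exp (g : SympDisk) :
    ContDiff ℝ ∞ fun t : ℝ => (circleFun g (Circle.exp t) : ℂ) := by
  have h := (contDiffOn g).comp (Circle.contDiff_coe_exp.contDiffOn (s := Set.univ))
    fun t _ => circle_mem_unitDisk _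
  exact contDiffOn_univ.1 h

theorem exists_contDiff_lift (g : SympDisk) :
    ∃ F : ℝ → ℝ, ContDiff ℝ ∞ F ∧ ∀ t, circleFun g (Circle.exp t) = Circle.exp (F t) := by
  have hc : Continuous fun t : ℝ => circleFun g (Circle.exp t) :=
    Topology.IsInducing.subtypeVal.continuous_iff.2 (contDiff_circleFun_exp g).continuous
  obtain ⟨e, he⟩ := Circle.exp_surjective (circleFun g (Circle.exp 0))
  obtain ⟨F, ⟨-, hF⟩, -⟩ := Circle.isCoveringMap_exp.existsUnique_continuousMap_lifts
    ⟨_, hc⟩ 0 e he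
  have hF' : ∀ t, circleFun g (Circle.exp t) = Circle.exp (F t) := fun t => (congrFun hF t).symm
  refine ⟨F, contDiff_of_contDiff_circleExp F.continuous ?_, hF'⟩
  simp only [← hF']
  exact contDiff_circleFun_exp g

/-- With `L` the derivative at `z` and `w = g(z)`, the tangent `iz` goes to `F'(t) · iw`, and `ω(z,
iz) = 1` becomes `F'(t) ⟨Lz, w⟩ = 1`. The outward normal cannot be sent inward, so `⟨Lz, w⟩ ≥ 0`,
which forces `F'(t) > 0`. -/
theorem deriv_lift_pos (g : SympDisk) {F : ℝ → ℝ} (hF : ContDiff ℝ ∞ F)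
    (h : ∀ t, circleFun g (Circle.exp t) = Circle.exp (F t)) (t : ℝ) : 0 < deriv F t := by
  set z : ℂ := (Circle.exp t : ℂ)
  have hz : z ∈ unitDisk := circle_mem_unitDisk _
  have hgz : diskFun g.1 z = Circle.exp (F t) := by rw [← h, coe_circleFun]
  set L := fderivWithin ℝ (diskFun g.1) unitDisk z
  have h1 : L (Complex.I * z) = deriv F t • (Complex.I * Circle.exp (F t)) := by
    refine (hasDerivAt_diskFun_exp g t).unique ?_
    simp only [← coe_circleFun, h]
    exact (Circle.hasDerivAt_coe_exp (F t)).scomp t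
      ((hF.differentiable (by simp) t).hasDerivAt)
  have h2 := stdSymplectic_fderivWithin g hz z (Complex.I * z)
  rw [Circle.stdSymplectic_I_mul] at h2
  change stdSymplectic (L z) (L (Complex.I * z)) = 1 at h2
  have h3 : IsLocalMaxOn (fun w => ‖diskFun g.1 w‖ ^ 2) unitDisk z := by
    refine IsMaxOn.localize fun w hw => ?_
    have a := mem_closedBall_zero_iff.1 (mapsTo_diskFun g.1 hw)
    have b : ‖diskFun g.1 z‖ = 1 := norm_diskFun_circle g _
    change ‖diskFun g.1 w‖ ^ 2 ≤ ‖diskFun g.1 z‖ ^ 2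
    rw [b]
    gcongr
  -- `|g|²` attains its maximum over the disk at `z`, so it does not increase along `-z`, the
  -- direction from `z` to the centre.
  have h4 := h3.hasFDerivWithinAt_nonpos (hasFDerivWithinAt g hz).norm_sq (y := -z)
    (mem_posTangentConeAt_of_segment_subset ((convex_closedBall 0 1).segment_subset hz (by simp)))
  rw [hgz] at h4
  change (2 • (innerSL ℝ (Circle.exp (F t) : ℂ)).comp L) (-z) ≤ 0 at h4
  rw [h1] at h2
  simp [Complex.inner] at h4
  simp [stdSymplectic] at h2
  have h5 : deriv F t * ((L z).re * (Circle.exp (F t) : ℂ).re +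
      (L z).im * (Circle.exp (F t) : ℂ).im) = 1 := by
    simp
    linarith
  have h6 : 0 ≤ (L z).re * (Circle.exp (F t) : ℂ).re + (L z).im * (Circle.exp (F t) : ℂ).im := by
    simp
    linarith
  by_contra hc
  nlinarith

/-- A monotone lift gains at least one full turn per period, hence is unbounded in both directions
and onto. That the gain is exactly `2π` is not needed here; it is `map_add_of_exp`. -/
theorem exists_orderIso_lift (g : SympDisk) :
    ∃ F : ℝ ≃o ℝ, ∀ t, circleFun g (Circle.exp t) = Circle.exp (F t) := by
  obtain ⟨F, hF, h⟩ := exists_contDiff_lift g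
  have hmono : StrictMono F := strictMono_of_deriv_pos (deriv_lift_pos g hF h)
  have hpi := Real.pi_pos
  have hstep : ∀ t, F t + 2 * Real.pi ≤ F (t + 2 * Real.pi) := by
    intro t
    have h1 : Circle.exp (F (t + 2 * Real.pi)) = Circle.exp (F t) := by
      rw [← h, ← h, Circle.exp_add_two_pi]
    obtain ⟨m, hm⟩ := Circle.eq_add_of_exp_eq h1
    have hlt : F t < F (t + 2 * Real.pi) := hmono (by linarith)
    have hm0 : (0 : ℝ) < m := by
      rw [hm] at hlt
      by_contra hc
      nlinarith
    have hm1 : 0 < m := by exact_mod_cast hm0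
    have hm2 : (1 : ℝ) ≤ m := by exact_mod_cast hm1
    rw [hm]
    nlinarith
  have hsteps : ∀ (n : ℕ) (t : ℝ), F t + 2 * Real.pi * n ≤ F (t + 2 * Real.pi * n) := by
    intro n t
    induction n with
    | zero => simp
    | succ n ih =>
      have := hstep (t + 2 * Real.pi * n)
      rw [show t + 2 * Real.pi * n + 2 * Real.pi = t + 2 * Real.pi * (n + 1 : ℕ) by
        push_cast; ring] at this
      push_cast at this ⊢
      linarith
  have hsurj : Function.Surjective F := by
    refine hF.continuous.surjective ?_ ?_
    · refine Filter.tendsto_atTop_atTop_of_monotone hmono.monotone fun b => ?_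
      obtain ⟨n, hn⟩ := exists_nat_ge ((b - F 0) / (2 * Real.pi))
      rw [div_le_iff₀ (by positivity)] at hn
      exact ⟨_, (by linarith : b ≤ F 0 + 2 * Real.pi * n).trans (hsteps n 0)⟩
    · refine Filter.tendsto_atBot_atBot_of_monotone hmono.monotone fun b => ?_
      obtain ⟨n, hn⟩ := exists_nat_ge ((F 0 - b) / (2 * Real.pi))
      rw [div_le_iff₀ (by positivity)] at hn
      refine ⟨-(2 * Real.pi * n), ?_⟩
      have := hsteps n (-(2 * Real.pi * n))
      rw [neg_add_cancel] at this
      linarith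
  exact ⟨hmono.orderIsoOfSurjective F hsurj, h⟩

theorem circlePerm_mem (g : SympDisk) : circlePerm g ∈ DiffCircle :=
  ⟨contMDiff_circle_iff.2 (contDiff_circleFun_exp g),
    contMDiff_circle_iff.2 (contDiff_circleFun_exp g⁻¹), exists_orderIso_lift g⟩

/-- The restriction homomorphism `Symp(D, ω) → Diff⁺(∂D)`. -/
def restrict : SympDisk →* DiffCircle where
  toFun g := ⟨circlePerm g, circlePerm_mem g⟩
  map_one' := by
    ext z : 3
    change diskFun 1 z = z
    rw [diskFun_one]
    rfl
  map_mul' g h := by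
    ext z : 3
    change diskFun (g.1 * h.1) z = diskFun g.1 (diskFun h.1 z)
    rw [diskFun_mul]
    rfl

theorem coe_restrict_apply (g : SympDisk) (z : Circle) :
    ((restrict g).1 z : ℂ) = diskFun g.1 z := rfl

theorem restrict_eq_one_iff {g : SympDisk} : restrict g = 1 ↔ g ∈ SympDiskRel := by
  constructor
  · intro h z hz
    have h1 := coe_restrict_apply g ⟨z, mem_sphere_zero_iff_norm.2 hz⟩
    rw [h] at h1
    apply Subtype.ext
    have h2 : (z : ℂ) = diskFun g.1 z := h1
    rw [diskFun_of_mem _ z.2] at h2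
    exact h2.symm
  · intro h
    ext z : 3
    rw [coe_restrict_apply, diskFun_of_mem _ (circle_mem_unitDisk z)]
    exact congrArg Subtype.val (h ⟨z, circle_mem_unitDisk z⟩ (Circle.norm_coe z))

end SympDisk

theorem IsBoundaryLift.of_proj_eq {g : SympDisk} {F : DiffCircleCover}
    (h : DiffCircleCover.proj F = SympDisk.restrict g) : IsBoundaryLift g F := fun t => by
  rw [← SympDisk.coe_restrict_apply, ← h, DiffCircleCover.proj_exp]

/-! ### Area-preserving maps of the strip -/

/-- In finite dimension an injective derivative is invertible, and the smooth local inverse, being a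
right inverse of `e` near the point, agrees with `e.symm` there. -/
theorem Equiv.contDiff_symm_of_injective_fderiv {E : Type*} [NormedAddCommGroup E]
    [NormedSpace ℝ E] [FiniteDimensional ℝ E] (e : E ≃ E) (he : ContDiff ℝ ∞ e)
    (hinj : ∀ x, Function.Injective (fderiv ℝ e x)) : ContDiff ℝ ∞ e.symm := by
  have : CompleteSpace E := FiniteDimensional.complete ℝ E
  rw [contDiff_iff_contDiffAt]
  intro y
  obtain ⟨x, rfl⟩ := e.surjective y
  let e' : E ≃L[ℝ] E := (LinearEquiv.ofInjectiveEndo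
    (fderiv ℝ e x : E →ₗ[ℝ] E) (hinj x)).toContinuousLinearEquiv
  have hd : HasFDerivAt e (e' : E →L[ℝ] E) x :=
    ((he.differentiable (by simp) x).hasFDerivAt).congr_fderiv (by ext; rfl)
  have hs := (he.contDiffAt (x := x)).to_localInverse hd (by simp)
  refine hs.congr_of_eventuallyEq ?_
  have hr := ((he.contDiffAt (x := x)).hasStrictFDerivAt' hd (by simp)).eventually_right_inverse
  filter_upwards [hr] with w hw
  rw [Equiv.symm_apply_eq]
  exact hw.symm

/-- `f(x) - mx` is monotone, so `f` lies beyond a line of slope `m` in each direction and tends to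
`±∞`. -/
theorem surjective_of_le_deriv {f : ℝ → ℝ} (hf : Differentiable ℝ f) {m : ℝ} (hm : 0 < m)
    (h : ∀ x, m ≤ deriv f x) : Function.Surjective f := by
  have hmono : Monotone fun x => f x - m * x := by
    refine monotone_of_deriv_nonneg (by fun_prop) fun x => ?_
    have hd : HasDerivAt (fun x => f x - m * x) (deriv f x - m) x := by
      exact ((hf x).hasDerivAt.sub ((hasDerivAt_id x).const_mul m)).congr_deriv (by simp)
    rw [hd.deriv]
    linarith [h x]
  refine hf.continuous.surjective ?_ ?_
  · have h1 : Filter.Tendsto (fun x => f 0 + m * x) Filter.atTop Filter.atTop :=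
      Filter.tendsto_atTop_add_const_left _ _ (Filter.tendsto_id.const_mul_atTop hm)
    refine Filter.tendsto_atTop_mono' _ ?_ h1
    filter_upwards [Filter.eventually_ge_atTop 0] with x hx
    have := hmono hx
    simp at this
    linarith
  · have h1 : Filter.Tendsto (fun x => f 0 + m * x) Filter.atBot Filter.atBot :=
      Filter.tendsto_atBot_add_const_left _ _ (Filter.tendsto_id.const_mul_atBot hm)
    refine Filter.tendsto_atBot_mono' _ ?_ h1
    filter_upwards [Filter.eventually_le_atBot 0] with x hx
    have := hmono hx
    simp at this
    linarith

/-- A smooth map `(x, y) ↦ (K(x, y), y)` with `∂K/∂x ≥ m > 0` is a diffeomorphism of the plane. -/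
theorem exists_skew_equiv {K K₁ K₂ : ℝ × ℝ → ℝ} (hK : ContDiff ℝ ∞ K) {m : ℝ} (hm : 0 < m)
    (hd : ∀ p, HasFDerivAt K (K₁ p • ContinuousLinearMap.fst ℝ ℝ ℝ +
      K₂ p • ContinuousLinearMap.snd ℝ ℝ ℝ) p) (hK₁ : ∀ p, m ≤ K₁ p) :
    ∃ e : ℝ × ℝ ≃ ℝ × ℝ, (∀ p, e p = (K p, p.2)) ∧ ContDiff ℝ ∞ e.symm ∧
      ∀ y, StrictMono fun x => K (x, y) := by
  have hline : ∀ y x, HasDerivAt (fun x => K (x, y)) (K₁ (x, y)) x := by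
    intro y x
    have h := (hd (x, y)).comp_hasDerivAt x ((hasDerivAt_id x).prodMk (hasDerivAt_const x y))
    exact h.congr_deriv (by simp)
  have hmono : ∀ y, StrictMono fun x => K (x, y) := fun y =>
    strictMono_of_deriv_pos fun x => by
      rw [(hline y x).deriv]
      exact hm.trans_le (hK₁ _)
  have hsurj : ∀ y, Function.Surjective fun x => K (x, y) := fun y =>
    surjective_of_le_deriv (fun x => (hline y x).differentiableAt) hm fun x => by
      rw [(hline y x).deriv]
      exact hK₁ _
  have hbij : Function.Bijective fun p : ℝ × ℝ => (K p, p.2) := by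
    constructor
    · rintro ⟨x, y⟩ ⟨x', y'⟩ h
      obtain ⟨h1, rfl⟩ := Prod.mk.inj h
      rw [(hmono _).injective h1]
    · rintro ⟨u, y⟩
      obtain ⟨x, hx⟩ := hsurj y u
      exact ⟨(x, y), Prod.ext hx rfl⟩
  refine ⟨Equiv.ofBijective _ hbij, fun p => rfl, ?_, hmono⟩
  refine Equiv.contDiff_symm_of_injective_fderiv _ (hK.prodMk contDiff_snd) fun p => ?_
  have h1 := (hd p).prodMk (hasFDerivAt_snd (𝕜 := ℝ) (p := p))
  change Function.Injective (fderiv ℝ (fun p : ℝ × ℝ => (K p, p.2)) p)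
  rw [h1.fderiv, injective_iff_map_eq_zero]
  rintro ⟨a, b⟩ hab
  have hb : b = 0 := congrArg Prod.snd hab
  have ha : K₁ p * a + K₂ p * b = 0 := congrArg Prod.fst hab
  subst hb
  have : K₁ p ≠ 0 := (hm.trans_le (hK₁ p)).ne'
  simp [this] at ha
  simp [ha]

/-- A function vanishing near `0` and at `1`, of slope `1` at `1` and with slopes in `[-δ, 1]`. -/
theorem exists_profile {δ : ℝ} (hδ : 0 < δ) : ∃ R ρ : ℝ → ℝ, ContDiff ℝ ∞ ρ ∧
    (∀ v, HasDerivAt R (ρ v) v) ∧ (∀ v ≤ (1 / 4 : ℝ), R v = 0 ∧ ρ v = 0) ∧ R 1 = 0 ∧ ρ 1 = 1 ∧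
    ∀ v, -δ ≤ ρ v ∧ ρ v ≤ 1 := by
  let b : ContDiffBump (1 / 2 : ℝ) := ⟨1 / 8, 1 / 4, by norm_num, by norm_num⟩
  have hb0 : ∀ v, 1 / 4 ≤ |v - 1 / 2| → b v = 0 := fun v hv => b.zero_of_le_dist hv
  have hbpos : 0 < ∫ v in (0 : ℝ)..1, b v :=
    intervalIntegral.integral_pos zero_lt_one b.continuous.continuousOn (fun v _ => b.nonneg)
      ⟨1 / 2, by norm_num, b.pos_of_mem_ball (by simp [b])⟩
  set β := ∫ v in (0 : ℝ)..1, b v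
  -- The step `T` below rises from `0` to `1` on `[1 - ε, 1]`, so its integral `τ` is at most `ε`.
  -- The bound `ε ≤ δβ` gives `τ / β ≤ δ`, and `ε ≤ 1/4` keeps `T` zero up to `3/4`.
  let ε := min (1 / 4) (δ * β)
  have hε : 0 < ε := lt_min (by norm_num) (by positivity)
  have hε4 : ε ≤ 1 / 4 := min_le_left _ _
  let T : ℝ → ℝ := fun v => Real.smoothTransition (1 + (v - 1) / ε)
  have hT : ContDiff ℝ ∞ T := by
    refine Real.smoothTransition.contDiff.comp ?_
    fun_prop
  have hT0 : ∀ v ≤ 1 - ε, T v = 0 := fun v hv => by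
    refine Real.smoothTransition.zero_of_nonpos ?_
    have : (v - 1) / ε ≤ -1 := by rw [div_le_iff₀ hε]; linarith
    linarith
  have hT01 : ∀ v, 0 ≤ T v ∧ T v ≤ 1 := fun v =>
    ⟨Real.smoothTransition.nonneg _, Real.smoothTransition.le_one _⟩
  set τ := ∫ v in (0 : ℝ)..1, T v with hτ
  have hτ0 : 0 ≤ τ := intervalIntegral.integral_nonneg zero_le_one fun v _ => (hT01 v).1
  have hτε : τ ≤ ε := by
    rw [hτ, ← intervalIntegral.integral_add_adjacent_intervals (b := 1 - ε)
      (hT.continuous.intervalIntegrable _ _) (hT.continuous.intervalIntegrable _ _)]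
    have h1 : ∫ v in (0 : ℝ)..(1 - ε), T v = 0 := by
      rw [intervalIntegral.integral_congr (g := fun _ => 0), intervalIntegral.integral_zero]
      intro v hv
      rw [Set.uIcc_of_le (by linarith)] at hv
      exact hT0 v hv.2
    have h2 : ∫ v in (1 - ε)..1, T v ≤ ∫ v in (1 - ε)..1, (1 : ℝ) :=
      intervalIntegral.integral_mono_on (by linarith) (hT.continuous.intervalIntegrable _ _)
        (continuous_const.intervalIntegrable _ _) fun v _ => (hT01 v).2
    rw [intervalIntegral.integral_const, smul_eq_mul] at h2
    linarith
  -- Subtracting this multiple of the bump, which is supported in `[1/4, 3/4]`, makes the integral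
  -- of `ρ` over `[0, 1]` vanish without changing `ρ 1 = T 1 = 1`. The most negative slope it can
  -- create is `-τ / β ≥ -δ`.
  let ρ : ℝ → ℝ := fun v => T v - τ / β * b v
  have hρ : ContDiff ℝ ∞ ρ := hT.sub (contDiff_const.mul b.contDiff)
  have hρ0 : ∀ v ≤ (1 / 4 : ℝ), ρ v = 0 := fun v hv => by
    have h1 := hT0 v (by linarith)
    have h2 := hb0 v (by rw [le_abs]; right; linarith)
    simp only [ρ, h1, h2]
    ring
  have hτβ : τ / β ≤ δ := by
    rw [div_le_iff₀ hbpos]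
    exact hτε.trans (min_le_right _ _)
  have hτβ0 : 0 ≤ τ / β := by positivity
  refine ⟨fun v => ∫ s in (0 : ℝ)..v, ρ s, ρ, hρ, fun v => ?_, fun v hv => ⟨?_, hρ0 v hv⟩, ?_, ?_,
    fun v => ⟨?_, ?_⟩⟩
  · exact intervalIntegral.integral_hasDerivAt_right (hρ.continuous.intervalIntegrable _ _)
      (hρ.continuous.stronglyMeasurableAtFilter _ _) hρ.continuous.continuousAt
  · change ∫ s in (0 : ℝ)..v, ρ s = 0
    rw [intervalIntegral.integral_congr (g := fun _ => 0), intervalIntegral.integral_zero]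
    intro s hs
    refine hρ0 s ?_
    rcases Set.mem_uIcc.1 hs with h | h <;> linarith [h.1, h.2]
  · change ∫ s in (0 : ℝ)..1, (T s - τ / β * b s) = 0
    rw [intervalIntegral.integral_sub (hT.continuous.intervalIntegrable _ _)
      ((b.continuous.const_mul (τ / β)).intervalIntegrable _ _),
      intervalIntegral.integral_const_mul, div_mul_cancel₀ _ hbpos.ne']
    exact sub_self _
  · have h1 : T 1 = 1 := Real.smoothTransition.one_of_one_le (by simp)
    have h2 := hb0 1 (by norm_num)
    simp only [ρ, h1, h2]
    ring
  · have h1 := (hT01 v).1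
    have h2 : τ / β * b v ≤ τ / β * 1 := mul_le_mul_of_nonneg_left b.le_one hτβ0
    change -δ ≤ T v - τ / β * b v
    linarith
  · have h1 := (hT01 v).2
    have h2 : 0 ≤ τ / β * b v := mul_nonneg hτβ0 b.nonneg
    change T v - τ / β * b v ≤ 1
    linarith

/-- Diffeomorphisms of the plane with coordinates `(r², θ)` which come from diffeomorphisms of the
unit disk equal to the identity near the centre. -/
structure IsStripEquiv (e : ℝ × ℝ ≃ ℝ × ℝ) : Prop where
  contDiff : ContDiff ℝ ∞ e
  contDiff_symm : ContDiff ℝ ∞ e.symm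
  apply_eq_self : ∀ p : ℝ × ℝ, p.1 ≤ 1 / 4 → e p = p
  apply_add : ∀ p : ℝ × ℝ, e (p + (0, 2 * Real.pi)) = e p + (0, 2 * Real.pi)
  fst_le_one_iff : ∀ p : ℝ × ℝ, (e p).1 ≤ 1 ↔ p.1 ≤ 1

namespace IsStripEquiv

theorem symm {e : ℝ × ℝ ≃ ℝ × ℝ} (h : IsStripEquiv e) : IsStripEquiv e.symm where
  contDiff := h.contDiff_symm
  contDiff_symm := h.contDiff
  apply_eq_self p hp := by rw [Equiv.symm_apply_eq, h.apply_eq_self p hp]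
  apply_add p := by rw [Equiv.symm_apply_eq, h.apply_add, Equiv.apply_symm_apply]
  fst_le_one_iff p := by rw [← h.fst_le_one_iff, Equiv.apply_symm_apply]

theorem trans {e e' : ℝ × ℝ ≃ ℝ × ℝ} (h : IsStripEquiv e) (h' : IsStripEquiv e') :
    IsStripEquiv (e.trans e') where
  contDiff := h'.contDiff.comp h.contDiff
  contDiff_symm := h.contDiff_symm.comp h'.contDiff_symm
  apply_eq_self p hp := by rw [Equiv.trans_apply, h.apply_eq_self p hp, h'.apply_eq_self p hp]
  apply_add p := by rw [Equiv.trans_apply, h.apply_add, h'.apply_add, Equiv.trans_apply]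
  fst_le_one_iff p := by rw [Equiv.trans_apply, h'.fst_le_one_iff, h.fst_le_one_iff]

/-- A point landing in the region where `e` is the identity is, by injectivity, its own image. -/
theorem fst_pos {e : ℝ × ℝ ≃ ℝ × ℝ} (h : IsStripEquiv e) {p : ℝ × ℝ} (hp : 0 < p.1) :
    0 < (e p).1 := by
  by_contra hc
  have h1 := e.injective (h.apply_eq_self (e p) (by linarith))
  rw [h1] at hc
  exact hc hp

theorem apply_add_int_mul {e : ℝ × ℝ ≃ ℝ × ℝ} (h : IsStripEquiv e) (p : ℝ × ℝ) (n : ℤ) :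
    e (p + (0, 2 * Real.pi * n)) = e p + (0, 2 * Real.pi * n) := by
  have hp : Function.Periodic (fun t : ℝ => e (p + (0, t)) - (0, t)) (2 * Real.pi) := fun t => by
    have h1 : p + (0, t + 2 * Real.pi) = p + (0, t) + (0, 2 * Real.pi) :=
      Prod.ext (by simp) (by simp [add_assoc])
    have h2 : ((0 : ℝ), t + 2 * Real.pi) = (0, t) + (0, 2 * Real.pi) := by
      rw [Prod.mk_add_mk, add_zero]
    simp only
    rw [h1, h.apply_add, h2, add_sub_add_right_eq_sub]
  have h3 := hp.int_mul n 0
  simp only [zero_add] at h3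
  rw [show ((0 : ℝ), (0 : ℝ)) = 0 from rfl, add_zero, sub_zero, sub_eq_iff_eq_add] at h3
  rw [mul_comm (2 * Real.pi)]
  exact h3

end IsStripEquiv

/-- The area form of the plane. -/
def areaForm (a b : ℝ × ℝ) : ℝ := a.1 * b.2 - a.2 * b.1

namespace DiffCircleCover

theorem deriv_pos (F : DiffCircleCover) (t : ℝ) : 0 < deriv F.1 t := by
  have h1 : 0 ≤ deriv F.1 t := F.1.monotone.deriv_nonneg
  have h2 := (hasDerivAt F⁻¹ (F.1 t)).comp t (hasDerivAt F t)
  have h3 : F⁻¹.1 ∘ F.1 = id := funext fun s => F.1.symm_apply_apply s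
  rw [h3] at h2
  have h4 := h2.unique (hasDerivAt_id t)
  refine h1.lt_of_ne fun h => ?_
  rw [← h, mul_zero] at h4
  exact zero_ne_one h4

theorem isCompact_range_deriv (F : DiffCircleCover) : IsCompact (Set.range (deriv F.1)) := by
  refine Function.Periodic.compact_of_continuous (c := 2 * Real.pi) (fun t => ?_)
    (by positivity) (continuous_deriv F)
  have h : (fun t => F.1 (t + 2 * Real.pi)) = fun t => F.1 t + 2 * Real.pi :=
    funext (map_add_two_pi F)
  rw [← deriv_comp_add_const, h, deriv_add_const]

/-- Every lift of a circle diffeomorphism extends to an area-preserving map of the strip: in terms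
of `φ(θ) = F(θ) - θ`, the map with generating function `vθ + R(v)φ(θ)`. -/
theorem exists_stripEquiv (F : DiffCircleCover) : ∃ e : ℝ × ℝ ≃ ℝ × ℝ, IsStripEquiv e ∧
    (∀ t, e (1, t) = (1, F.1 t)) ∧
    ∀ p a b, areaForm (fderiv ℝ e p a) (fderiv ℝ e p b) = areaForm a b := by
  obtain ⟨m₀, ⟨⟨t₀, ht₀⟩, hm₀⟩⟩ := (isCompact_range_deriv F).exists_isLeast (Set.range_nonempty _)
  obtain ⟨M, ⟨-, hM⟩⟩ := (isCompact_range_deriv F).exists_isGreatest (Set.range_nonempty _)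
  have hm₀pos : 0 < m₀ := ht₀ ▸ deriv_pos F t₀
  have hm₀' : ∀ t, m₀ ≤ deriv F.1 t := fun t => hm₀ ⟨t, rfl⟩
  have hM' : ∀ t, deriv F.1 t ≤ M := fun t => hM ⟨t, rfl⟩
  have hMpos : 0 < M := (deriv_pos F 0).trans_le (hM' 0)
  -- `δ` is chosen so that `δ (M + 1) = 1/2`, where `M + 1` bounds `F' - 1` from above.
  obtain ⟨R, ρ, hρ, hR, hR0, hR1, hρ1, hρb⟩ := exists_profile (δ := 1 / (2 * (M + 1)))
    (by positivity)
  let φ : ℝ → ℝ := fun t => F.1 t - t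
  let ψ : ℝ → ℝ := fun t => deriv F.1 t - 1
  have hψc : ContDiff ℝ ∞ ψ :=
    ((contDiff_infty_iff_deriv.1 (contDiff F)).2).sub contDiff_const
  have hφc : ContDiff ℝ ∞ φ := (contDiff F).sub contDiff_id
  have hφ : ∀ t, HasDerivAt φ (ψ t) t := fun t => (hasDerivAt F t).sub (hasDerivAt_id t)
  have hφ2 : ∀ t, φ (t + 2 * Real.pi) = φ t := fun t => by
    simp only [φ, map_add_two_pi]; ring
  have hψ2 : ∀ t, ψ (t + 2 * Real.pi) = ψ t := fun t => by
    have h : (fun t => F.1 (t + 2 * Real.pi)) = fun t => F.1 t + 2 * Real.pi :=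
      funext (map_add_two_pi F)
    simp only [ψ]
    rw [← deriv_comp_add_const, h, deriv_add_const]
  have hRc : ContDiff ℝ ∞ R := contDiff_infty_iff_deriv.2
    ⟨fun v => (hR v).differentiableAt, (funext fun v => (hR v).deriv : deriv R = ρ) ▸ hρ⟩
  -- This is the mixed derivative `∂²/∂v∂θ` of the generating function. Where `F' ≥ 1` the lower
  -- bound `-δ` on `ρ` keeps it at least `1/2`; where `F' < 1` the upper bound `ρ ≤ 1` keeps it at
  -- least `F' ≥ m₀`.
  have hbound : ∀ v t, min m₀ (1 / 2) ≤ 1 + ρ v * ψ t := by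
    intro v t
    obtain ⟨h1, h2⟩ := hρb v
    have h3 : m₀ - 1 ≤ ψ t := by simp only [ψ]; linarith [hm₀' t]
    have h4 : ψ t ≤ M + 1 := by simp only [ψ]; linarith [hM' t]
    have h5 : 1 / (2 * (M + 1)) * (M + 1) = 1 / 2 := by field_simp
    have h6 := min_le_left m₀ (1 / 2)
    have h7 := min_le_right m₀ (1 / 2)
    rcases le_or_gt 0 (ψ t) with h | h
    · have : -(1 / (2 * (M + 1))) * (M + 1) ≤ ρ v * ψ t := by
        have h8 : (0 : ℝ) < 1 / (2 * (M + 1)) := by positivity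
        nlinarith
      linarith
    · nlinarith
  have hmin : 0 < min m₀ (1 / 2) := lt_min hm₀pos (by norm_num)
  have hf1 : ∀ p : ℝ × ℝ, HasFDerivAt (fun p : ℝ × ℝ => p.1) (ContinuousLinearMap.fst ℝ ℝ ℝ) p :=
    fun p => hasFDerivAt_fst
  have hf2 : ∀ p : ℝ × ℝ, HasFDerivAt (fun p : ℝ × ℝ => p.2) (ContinuousLinearMap.snd ℝ ℝ ℝ) p :=
    fun p => hasFDerivAt_snd
  have hdA : ∀ p : ℝ × ℝ, HasFDerivAt (fun p : ℝ × ℝ => p.1 + R p.1 * ψ p.2)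
      ((1 + ρ p.1 * ψ p.2) • ContinuousLinearMap.fst ℝ ℝ ℝ +
        (R p.1 * deriv ψ p.2) • ContinuousLinearMap.snd ℝ ℝ ℝ) p := by
    intro p
    have h1 := (hR p.1).comp_hasFDerivAt p (hf1 p)
    have h2 := ((hψc.differentiable (by simp) p.2).hasDerivAt).comp_hasFDerivAt p (hf2 p)
    refine ((hf1 p).add (h1.mul h2)).congr_fderiv ?_
    ext <;> simp
    ring
  have hdB : ∀ p : ℝ × ℝ, HasFDerivAt (fun p : ℝ × ℝ => p.1 + ρ p.2 * φ p.1)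
      ((1 + ρ p.2 * ψ p.1) • ContinuousLinearMap.fst ℝ ℝ ℝ +
        (deriv ρ p.2 * φ p.1) • ContinuousLinearMap.snd ℝ ℝ ℝ) p := by
    intro p
    have h1 := ((hρ.differentiable (by simp) p.2).hasDerivAt).comp_hasFDerivAt p (hf2 p)
    have h2 := (hφ p.1).comp_hasFDerivAt p (hf1 p)
    refine ((hf1 p).add (h1.mul h2)).congr_fderiv ?_
    ext <;> simp
    ring
  have hcA : ContDiff ℝ ∞ fun p : ℝ × ℝ => p.1 + R p.1 * ψ p.2 :=
    contDiff_fst.add ((hRc.comp contDiff_fst).mul (hψc.comp contDiff_snd))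
  have hcB : ContDiff ℝ ∞ fun p : ℝ × ℝ => p.1 + ρ p.2 * φ p.1 :=
    contDiff_fst.add ((hρ.comp contDiff_snd).mul (hφc.comp contDiff_fst))
  -- With `S(v, θ) = vθ + R(v)φ(θ)`, the map `A` is `(v, θ) ↦ (∂S/∂θ, θ)` and `B` is `(v, θ) ↦ (v,
  -- ∂S/∂v)`. The desired map is `B ∘ A⁻¹`; `B'` is `B` with the coordinates exchanged, to fit the
  -- skew form.
  obtain ⟨A, hA, hAs, hAm⟩ := exists_skew_equiv hcA hmin hdA fun p => hbound _ _
  obtain ⟨B', hB', hBs', -⟩ := exists_skew_equiv hcB hmin hdB fun p => hbound _ _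
  let B : ℝ × ℝ ≃ ℝ × ℝ := (Equiv.prodComm ℝ ℝ).trans (B'.trans (Equiv.prodComm ℝ ℝ))
  have hswap : ContDiff ℝ ∞ (Prod.swap : ℝ × ℝ → ℝ × ℝ) := contDiff_snd.prodMk contDiff_fst
  have hB : ∀ p, B p = (p.1, p.2 + ρ p.1 * φ p.2) := fun p => by
    change (B' p.swap).swap = _
    rw [hB']
    rfl
  have hsA : IsStripEquiv A := by
    refine ⟨?_, hAs, fun p hp => ?_, fun p => ?_, fun p => ?_⟩
    · rw [show (A : ℝ × ℝ → ℝ × ℝ) = fun p => (p.1 + R p.1 * ψ p.2, p.2) from funext hA]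
      exact hcA.prodMk contDiff_snd
    · rw [hA, (hR0 _ hp).1, zero_mul, add_zero]
    · rw [hA, hA]
      ext <;> simp [hψ2]
    · have h := (hAm p.2).le_iff_le (a := p.1) (b := 1)
      simp only [hR1, zero_mul, add_zero] at h
      rw [hA]
      exact h
  have hsB : IsStripEquiv B := by
    refine ⟨?_, ?_, fun p hp => ?_, fun p => ?_, fun p => ?_⟩
    · rw [show (B : ℝ × ℝ → ℝ × ℝ) = fun p => (p.1, p.2 + ρ p.1 * φ p.2) from funext hB]
      exact contDiff_fst.prodMk (hcB.comp hswap)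
    · exact hswap.comp (hBs'.comp hswap)
    · rw [hB, (hR0 _ hp).2, zero_mul, add_zero]
    · rw [hB, hB]
      ext
      · simp
      · simp [hφ2]
        ring
    · rw [hB]
  refine ⟨A.symm.trans B, hsA.symm.trans hsB, fun t => ?_, fun q a b => ?_⟩
  -- On `v = 1` the map `A` is the identity because `R 1 = 0`, and `B` adds `φ` because `ρ 1 = 1`.
  · have h1 : A (1, t) = (1, t) := by
      rw [hA]; simp [hR1]
    rw [Equiv.trans_apply, (Equiv.symm_apply_eq A).2 h1.symm, hB]
    simp [hρ1, φ]
  -- At the same point `p` both `A` and `B` have Jacobian `1 + ρψ`, so `B ∘ A⁻¹` has Jacobian `1`.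
  -- Vectors are written as images under the derivative of `A` to avoid differentiating its inverse.
  · obtain ⟨p, rfl⟩ := A.surjective q
    have hDA : HasFDerivAt A (((1 + ρ p.1 * ψ p.2) • ContinuousLinearMap.fst ℝ ℝ ℝ +
        (R p.1 * deriv ψ p.2) • ContinuousLinearMap.snd ℝ ℝ ℝ).prod
        (ContinuousLinearMap.snd ℝ ℝ ℝ)) p := by
      rw [show (A : ℝ × ℝ → ℝ × ℝ) = fun p => (p.1 + R p.1 * ψ p.2, p.2) from funext hA]
      exact (hdA p).prodMk (hf2 p)
    have hDB : HasFDerivAt B ((ContinuousLinearMap.fst ℝ ℝ ℝ).prod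
        ((1 + ρ p.1 * ψ p.2) • ContinuousLinearMap.snd ℝ ℝ ℝ +
        (deriv ρ p.1 * φ p.2) • ContinuousLinearMap.fst ℝ ℝ ℝ)) p := by
      rw [show (B : ℝ × ℝ → ℝ × ℝ) = fun p => (p.1, p.2 + ρ p.1 * φ p.2) from funext hB]
      refine (hf1 p).prodMk ?_
      have h := (hdB p.swap).comp p ((hf2 p).prodMk (hf1 p))
      exact h
    have hDe := (((hsA.symm.trans hsB).contDiff.differentiable (by simp)) (A p)).hasFDerivAt
    have hcomp : (A.symm.trans B : ℝ × ℝ → ℝ × ℝ) ∘ A = B := funext fun x => by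
      simp
    have hD := hDe.comp p hDA
    rw [hcomp] at hD
    have hEq := fun v => congrArg (fun L : ℝ × ℝ →L[ℝ] ℝ × ℝ => L v) (hD.unique hDB)
    have hK : (1 + ρ p.1 * ψ p.2) ≠ 0 := (hmin.trans_le (hbound _ _)).ne'
    have hsurj : ∀ w : ℝ × ℝ, ∃ v : ℝ × ℝ,
        ((1 + ρ p.1 * ψ p.2) * v.1 + R p.1 * deriv ψ p.2 * v.2, v.2) = w := fun w =>
      ⟨((w.1 - R p.1 * deriv ψ p.2 * w.2) / (1 + ρ p.1 * ψ p.2), w.2), by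
        ext
        · simp only
          rw [mul_div_cancel₀ _ hK]
          ring
        · rfl⟩
    obtain ⟨a, rfl⟩ := hsurj a
    obtain ⟨b, rfl⟩ := hsurj b
    have ha : fderiv ℝ (A.symm.trans B) (A p)
        ((1 + ρ p.1 * ψ p.2) * a.1 + R p.1 * deriv ψ p.2 * a.2, a.2) =
        (a.1, (1 + ρ p.1 * ψ p.2) * a.2 + deriv ρ p.1 * φ p.2 * a.1) := hEq a
    have hb : fderiv ℝ (A.symm.trans B) (A p)
        ((1 + ρ p.1 * ψ p.2) * b.1 + R p.1 * deriv ψ p.2 * b.2, b.2) =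
        (b.1, (1 + ρ p.1 * ψ p.2) * b.2 + deriv ρ p.1 * φ p.2 * b.1) := hEq b
    rw [ha, hb]
    simp only [areaForm]
    ring

end DiffCircleCover

/-! ### Extension of circle diffeomorphisms to symplectomorphisms of the disk -/

/-- The point of the plane with coordinates `(r², θ)`. -/
def actionAngle (p : ℝ × ℝ) : ℂ := polarMap (√p.1, p.2)

theorem norm_sq_actionAngle {p : ℝ × ℝ} (hp : 0 ≤ p.1) : ‖actionAngle p‖ ^ 2 = p.1 := by
  rw [actionAngle, norm_polarMap, sq_abs, Real.sq_sqrt hp]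

theorem actionAngle_norm_sq (z : ℂ) {t θ : ℝ} (ht : t = ‖z‖ ^ 2)
    (h : (‖z‖ : ℂ) * Circle.exp θ = z) : actionAngle (t, θ) = z := by
  rw [actionAngle, polarMap, ht, Real.sqrt_sq (norm_nonneg z)]
  exact h

theorem norm_mul_exp_arg (z : ℂ) : (‖z‖ : ℂ) * Circle.exp z.arg = z := by
  rw [Circle.coe_exp, Complex.norm_mul_exp_arg_mul_I]

theorem norm_mul_exp_add_arg_div (z : ℂ) (θ : ℝ) :
    (‖z‖ : ℂ) * Circle.exp (θ + (z / Circle.exp θ).arg) = z := by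
  have h := norm_mul_exp_arg (z / Circle.exp θ)
  rw [norm_div, Circle.norm_coe, div_one, eq_div_iff (Circle.coe_ne_zero _)] at h
  rw [Circle.exp_add, Circle.coe_mul]
  linear_combination h

theorem hasFDerivAt_actionAngle {p : ℝ × ℝ} (hp : 0 < p.1) :
    HasFDerivAt actionAngle (((1 / (2 * √p.1)) • ContinuousLinearMap.fst ℝ ℝ ℝ).smulRight
      (Circle.exp p.2 : ℂ) +
      (ContinuousLinearMap.snd ℝ ℝ ℝ).smulRight (Complex.I * actionAngle p)) p := by
  have h1 : HasFDerivAt (fun p : ℝ × ℝ => (√p.1, p.2))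
      (((1 / (2 * √p.1)) • ContinuousLinearMap.fst ℝ ℝ ℝ).prod (ContinuousLinearMap.snd ℝ ℝ ℝ)) p :=
    ((hasFDerivAt_fst (𝕜 := ℝ) (p := p)).sqrt hp.ne').prodMk (hasFDerivAt_snd (𝕜 := ℝ) (p := p))
  exact (hasFDerivAt_polarMap _).comp p h1

/-- `r dr ∧ dθ = (1/2) d(r²) ∧ dθ`. The constant factor `1/2` is why area preservation in `(r², θ)`
is the same as preserving `ω`. -/
theorem stdSymplectic_fderiv_actionAngle {p : ℝ × ℝ} (hp : 0 < p.1) (a b : ℝ × ℝ) :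
    stdSymplectic (fderiv ℝ actionAngle p a) (fderiv ℝ actionAngle p b) = areaForm a b / 2 := by
  have h := (Circle.exp p.2).normSq_coe
  rw [Complex.normSq_apply] at h
  have hs : √p.1 ≠ 0 := (Real.sqrt_pos.2 hp).ne'
  rw [(hasFDerivAt_actionAngle hp).fderiv]
  simp only [add_apply, ContinuousLinearMap.smulRight_apply, smul_apply, smul_eq_mul,
    ContinuousLinearMap.coe_fst', ContinuousLinearMap.coe_snd', actionAngle, polarMap,
    stdSymplectic, areaForm, Complex.add_re, Complex.add_im, Complex.real_smul, Complex.mul_re,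
    Complex.mul_im, Complex.ofReal_re, Complex.ofReal_im, Complex.I_re, Complex.I_im]
  field_simp
  linear_combination (2 * √p.1 ^ 2 * (a.1 * b.2 - a.2 * b.1)) * h

theorem contDiffAt_actionAngle {p : ℝ × ℝ} (hp : 0 < p.1) : ContDiffAt ℝ ∞ actionAngle p :=
  (Complex.ofRealCLM.contDiff.contDiffAt.comp p (contDiffAt_fst.sqrt hp.ne')).mul
    (Circle.contDiff_coe_exp.contDiffAt.comp p contDiffAt_snd)

/-- The map of the plane which is `e` in the coordinates `(r², θ)`. -/
def diskMap (e : ℝ × ℝ ≃ ℝ × ℝ) (z : ℂ) : ℂ := actionAngle (e (‖z‖ ^ 2, z.arg))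

namespace IsStripEquiv

/-- Any choice of angle may replace `arg`: two choices differ by a multiple of `2π`, with which `e`
commutes, and at the centre the angle is irrelevant. -/
theorem diskMap_eq {e : ℝ × ℝ ≃ ℝ × ℝ} (h : IsStripEquiv e) {z : ℂ} {θ : ℝ}
    (hθ : (‖z‖ : ℂ) * Circle.exp θ = z) : diskMap e z = actionAngle (e (‖z‖ ^ 2, θ)) := by
  by_cases hz : z = 0
  · subst hz
    simp only [diskMap, norm_zero]
    rw [h.apply_eq_self _ (by norm_num), h.apply_eq_self _ (by norm_num)]
    simp [actionAngle, polarMap]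
  · have h1 : Circle.exp z.arg = Circle.exp θ := by
      apply Circle.ext
      have hn : (‖z‖ : ℂ) ≠ 0 := by simpa using hz
      exact mul_left_cancel₀ hn ((norm_mul_exp_arg z).trans hθ.symm)
    obtain ⟨m, hm⟩ := Circle.eq_add_of_exp_eq h1
    have h2 : (‖z‖ ^ 2, z.arg) = ((‖z‖ ^ 2, θ) : ℝ × ℝ) + (0, 2 * Real.pi * m) := by
      rw [hm]; simp
    rw [diskMap, h2, h.apply_add_int_mul]
    simp only [actionAngle, polarMap, Prod.fst_add, Prod.snd_add, add_zero]
    rw [Circle.exp_add, Circle.exp_two_pi_mul_int, mul_one]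

theorem diskMap_actionAngle {e : ℝ × ℝ ≃ ℝ × ℝ} (h : IsStripEquiv e) {p : ℝ × ℝ} (hp : 0 ≤ p.1) :
    diskMap e (actionAngle p) = actionAngle (e p) := by
  rw [h.diskMap_eq (θ := p.2), norm_sq_actionAngle hp]
  rw [actionAngle, norm_polarMap, abs_of_nonneg (Real.sqrt_nonneg _)]
  rfl

theorem diskMap_eq_self {e : ℝ × ℝ ≃ ℝ × ℝ} (h : IsStripEquiv e) {z : ℂ} (hz : ‖z‖ ^ 2 ≤ 1 / 4) :
    diskMap e z = z := by
  rw [diskMap, h.apply_eq_self _ hz]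
  exact actionAngle_norm_sq z rfl (norm_mul_exp_arg z)

theorem diskMap_symm_diskMap {e : ℝ × ℝ ≃ ℝ × ℝ} (h : IsStripEquiv e) (z : ℂ) :
    diskMap e.symm (diskMap e z) = z := by
  rcases le_or_gt (‖z‖ ^ 2) (1 / 4) with hz | hz
  · rw [h.diskMap_eq_self hz, h.symm.diskMap_eq_self hz]
  · rw [diskMap.eq_1 e z, h.symm.diskMap_actionAngle (h.fst_pos (by simpa using by linarith)).le,
      Equiv.symm_apply_apply]
    exact actionAngle_norm_sq z rfl (norm_mul_exp_arg z)

theorem diskMap_mem {e : ℝ × ℝ ≃ ℝ × ℝ} (h : IsStripEquiv e) {z : ℂ} (hz : z ∈ unitDisk) :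
    diskMap e z ∈ unitDisk := by
  rcases le_or_gt (‖z‖ ^ 2) (1 / 4) with hz' | hz'
  · rwa [h.diskMap_eq_self hz']
  · rw [unitDisk, mem_closedBall_zero_iff] at hz ⊢
    have h1 : ‖diskMap e z‖ ^ 2 ≤ 1 := by
      rw [diskMap, norm_sq_actionAngle (h.fst_pos (by simpa using by linarith)).le,
        h.fst_le_one_iff]
      exact pow_le_one₀ (norm_nonneg z) hz
    exact (sq_le_one_iff₀ (norm_nonneg _)).1 h1

theorem eventually_diskMap_eq_self {e : ℝ × ℝ ≃ ℝ × ℝ} (h : IsStripEquiv e) {z : ℂ}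
    (hz : ‖z‖ ^ 2 < 1 / 4) : diskMap e =ᶠ[nhds z] id := by
  have hc : Continuous fun w : ℂ => ‖w‖ ^ 2 := by fun_prop
  filter_upwards [hc.continuousAt.eventually_lt continuousAt_const hz] with w hw
  exact h.diskMap_eq_self hw.le

/-- Near the centre the map is the identity. Elsewhere the angle is measured from `arg z`, a branch
smooth around `z`, so the jump of `arg` plays no role. -/
theorem contDiff_diskMap {e : ℝ × ℝ ≃ ℝ × ℝ} (h : IsStripEquiv e) : ContDiff ℝ ∞ (diskMap e) := by
  rw [contDiff_iff_contDiffAt]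
  intro z
  rcases lt_or_ge (‖z‖ ^ 2) (1 / 4) with hz | hz
  · exact contDiffAt_id.congr_of_eventuallyEq (h.eventually_diskMap_eq_self hz)
  · have hz0 : z ≠ 0 := by rintro rfl; norm_num at hz
    have h1 : ContDiffAt ℝ ∞
        (fun w : ℂ => actionAngle (e (‖w‖ ^ 2, z.arg + (w / Circle.exp z.arg).arg))) z := by
      have hin : ContDiffAt ℝ ∞
          (fun w : ℂ => (‖w‖ ^ 2, z.arg + (w / Circle.exp z.arg).arg)) z := by
        refine (contDiff_norm_sq ℝ).contDiffAt.prodMk (contDiffAt_const.add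
          (ContDiffAt.comp (g := Complex.arg) z (Complex.contDiffAt_arg ?_)
            (contDiffAt_id.div_const _)))
        have h2 : z / Circle.exp z.arg = (‖z‖ : ℂ) := by
          rw [div_eq_iff (Circle.coe_ne_zero _), norm_mul_exp_arg]
        change z / (Circle.exp z.arg : ℂ) ∈ Complex.slitPlane
        rw [h2]
        simpa [Complex.slitPlane] using hz0
      refine ContDiffAt.comp (g := actionAngle) z (contDiffAt_actionAngle (h.fst_pos ?_))
        (h.contDiff.contDiffAt.comp z hin)
      simpa using by linarith
    refine h1.congr_of_eventuallyEq (Filter.Eventually.of_forall fun w => ?_)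
    exact h.diskMap_eq (norm_mul_exp_add_arg_div w z.arg)

/-- Away from the centre the map is conjugate to `e` by the coordinates `(r², θ)`, which scale the
area form by the same constant at source and target. -/
theorem stdSymplectic_fderiv_diskMap {e : ℝ × ℝ ≃ ℝ × ℝ} (h : IsStripEquiv e)
    (harea : ∀ p a b, areaForm (fderiv ℝ e p a) (fderiv ℝ e p b) = areaForm a b) (z u v : ℂ) :
    stdSymplectic (fderiv ℝ (diskMap e) z u) (fderiv ℝ (diskMap e) z v) = stdSymplectic u v := by
  rcases lt_or_ge (‖z‖ ^ 2) (1 / 4) with hz | hz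
  · rw [(h.eventually_diskMap_eq_self hz).fderiv_eq, fderiv_id]
    rfl
  · obtain ⟨p, hp, rfl⟩ : ∃ p : ℝ × ℝ, 0 < p.1 ∧ actionAngle p = z :=
      ⟨(‖z‖ ^ 2, z.arg), by simpa using by linarith,
        actionAngle_norm_sq z rfl (norm_mul_exp_arg z)⟩
    have hE : ∀ {q : ℝ × ℝ}, 0 < q.1 → HasFDerivAt actionAngle (fderiv ℝ actionAngle q) q :=
      fun hq => (hasFDerivAt_actionAngle hq).differentiableAt.hasFDerivAt
    have he := (h.contDiff.differentiable (by simp) p).hasFDerivAt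
    have hg := (h.contDiff_diskMap.differentiable (by simp) (actionAngle p)).hasFDerivAt
    have h1 := hg.comp p (hE hp)
    have h2 := (hE (h.fst_pos hp)).comp p he
    have hev : diskMap e ∘ actionAngle =ᶠ[nhds p] actionAngle ∘ e := by
      filter_upwards [continuousAt_const.eventually_lt continuousAt_fst hp] with q hq
      exact h.diskMap_actionAngle hq.le
    have h3 := fun a => congrArg (fun L : ℝ × ℝ →L[ℝ] ℂ => L a)
      ((h1.congr_of_eventuallyEq hev.symm).unique h2)
    have hinj : Function.Injective (fderiv ℝ actionAngle p) := by
      rw [injective_iff_map_eq_zero]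
      intro a ha
      have h4 := stdSymplectic_fderiv_actionAngle hp a
      rw [ha] at h4
      have h5 := h4 (0, 1)
      have h6 := h4 (1, 0)
      simp [stdSymplectic, areaForm] at h5 h6
      exact Prod.ext (by simpa using h5.symm) (by simpa using h6.symm)
    have hsurj : Function.Surjective (fderiv ℝ actionAngle p) :=
      (LinearMap.injective_iff_surjective_of_finrank_eq_finrank
        (f := (fderiv ℝ actionAngle p : ℝ × ℝ →ₗ[ℝ] ℂ)) (by simp)).1 hinj
    obtain ⟨a, rfl⟩ := hsurj u
    obtain ⟨b, rfl⟩ := hsurj v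
    have ha : fderiv ℝ (diskMap e) (actionAngle p) (fderiv ℝ actionAngle p a) =
      fderiv ℝ actionAngle (e p) (fderiv ℝ e p a) := h3 a
    have hb : fderiv ℝ (diskMap e) (actionAngle p) (fderiv ℝ actionAngle p b) =
      fderiv ℝ actionAngle (e p) (fderiv ℝ e p b) := h3 b
    rw [ha, hb, stdSymplectic_fderiv_actionAngle (h.fst_pos hp),
      stdSymplectic_fderiv_actionAngle hp, harea]

/-- The permutation of the unit disk given by `diskMap`. -/
def diskPerm {e : ℝ × ℝ ≃ ℝ × ℝ} (h : IsStripEquiv e) : Equiv.Perm unitDisk where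
  toFun z := ⟨diskMap e z, h.diskMap_mem z.2⟩
  invFun z := ⟨diskMap e.symm z, h.symm.diskMap_mem z.2⟩
  left_inv z := Subtype.ext (h.diskMap_symm_diskMap z)
  right_inv z := Subtype.ext (h.symm.diskMap_symm_diskMap z)

theorem eqOn_diskFun_diskPerm {e : ℝ × ℝ ≃ ℝ × ℝ} (h : IsStripEquiv e) :
    Set.EqOn (diskFun h.diskPerm) (diskMap e) unitDisk := fun _ hz => diskFun_of_mem _ hz

theorem diskPerm_mem {e : ℝ × ℝ ≃ ℝ × ℝ} (h : IsStripEquiv e)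
    (harea : ∀ p a b, areaForm (fderiv ℝ e p a) (fderiv ℝ e p b) = areaForm a b) :
    h.diskPerm ∈ SympDisk := by
  refine ⟨h.contDiff_diskMap.contDiffOn.congr h.eqOn_diskFun_diskPerm,
    h.symm.contDiff_diskMap.contDiffOn.congr h.symm.eqOn_diskFun_diskPerm, fun z hz u v => ?_⟩
  rw [fderivWithin_congr h.eqOn_diskFun_diskPerm (h.eqOn_diskFun_diskPerm hz),
    (h.contDiff_diskMap.differentiable (by simp) z).fderivWithin (uniqueDiffOn_unitDisk z hz)]
  exact h.stdSymplectic_fderiv_diskMap harea z u v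

end IsStripEquiv

theorem SympDisk.restrict_surjective : Function.Surjective SympDisk.restrict := by
  intro φ
  obtain ⟨F, rfl⟩ := DiffCircleCover.proj_surjective φ
  obtain ⟨e, he, hb, harea⟩ := DiffCircleCover.exists_stripEquiv F
  refine ⟨⟨he.diskPerm, he.diskPerm_mem harea⟩, ?_⟩
  ext z : 3
  obtain ⟨t, rfl⟩ := Circle.exp_surjective z
  have h1 : (Circle.exp t : ℂ) = actionAngle (1, t) := by simp [actionAngle, polarMap]
  rw [coe_restrict_apply, DiffCircleCover.proj_exp,
    he.eqOn_diskFun_diskPerm (circle_mem_unitDisk _), h1, he.diskMap_actionAngle zero_le_one, hb]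
  simp [actionAngle, polarMap]

/-- The extension `1 → G_rel → G → Diff⁺(∂D) → 1`. -/
def diskExtension : GroupExtension SympDiskRel SympDisk DiffCircle where
  inl := SympDiskRel.subtype
  rightHom := SympDisk.restrict
  inl_injective := SympDiskRel.subtype_injective
  range_inl_eq_ker_rightHom := by
    ext g
    rw [MonoidHom.mem_ker, SympDisk.restrict_eq_one_iff, Subgroup.range_subtype]
  rightHom_surjective := SympDisk.restrict_surjective

/-! ### The transgression and the extension class -/

namespace GroupExtension

/-- `d₂` of an invariant homomorphism may be computed from any cochain in `Z_2^{0,1}` extending it: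
apply `δ` and descend. -/
theorem transgression_restrictZ {k N G Q V : Type u} [CommRing k] [Group N] [Group G] [Group Q]
    [AddCommGroup V] [Module k V] (S : GroupExtension N G Q)
    (c : LHS.Z S.inl.range (Rep.trivial k G V) 2 0 1) :
    S.transgression k (S.restrictZ k c) = groupCohomology.H2π (Rep.trivial k Q V)
      (S.descendZ k (LHS.δZ_map S.inl.range (Rep.trivial k G V) 2 0 1 c)) := by
  have h : (S.edgeZeroOne (V := V) k).symm (S.restrictZ k c) = Submodule.Quotient.mk c := by
    rw [LinearEquiv.symm_apply_eq]
    rfl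
  rw [transgression, LinearMap.comp_apply, LinearMap.comp_apply, LinearEquiv.coe_coe,
    LinearEquiv.coe_coe, h]
  rfl

/-- A factor set of an extension induced along `f` is described by lifts `e x` of the elements of
the quotient and elements `a x` of the new kernel. -/
theorem exists_lifts_pushout {V Q : Type u} {N E : Type*} [AddCommGroup V] [Group N] [Group E]
    [Group Q] (S : GroupExtension N E Q) (hS : S.inl.range ≤ Subgroup.center E)
    (f : N →* Multiplicative V) :
    letI := S.pushoutKernel_normal hS f
    ∃ (e : Q → E) (a : Q → V), (∀ x, S.rightHom (e x) = x) ∧ ∀ x y, ∃ n : N,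
      e x * e y = S.inl n * e (x * y) ∧
        a x + a y + Multiplicative.toAdd (f n) = (S.pushout hS f).factorSet (x, y) + a (x * y) := by
  let _ := S.pushoutKernel_normal hS f
  have h : ∀ x, ∃ p : E × Multiplicative V,
      (QuotientGroup.mk p : S.PushoutGroup f) = (S.pushout hS f).sec x := fun x =>
    QuotientGroup.mk_surjective _
  choose p hp using h
  refine ⟨fun x => (p x).1, fun x => Multiplicative.toAdd (p x).2, fun x => ?_, fun x y => ?_⟩
  · have h1 := (S.pushout hS f).rightHom_sec x
    rw [← hp] at h1
    exact h1
  · have h1 := (S.pushout hS f).inl_factorSet x y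
    rw [eq_mul_inv_iff_mul_eq, ← hp, ← hp, ← hp] at h1
    have h2 : (QuotientGroup.mk ((1, Multiplicative.ofAdd ((S.pushout hS f).factorSet (x, y))) *
        p (x * y)) : S.PushoutGroup f) = QuotientGroup.mk (p x * p y) := h1
    -- The two representatives differ by an element `(i(n), f(n)⁻¹)` of the subgroup divided out;
    -- its components are the two required equations.
    obtain ⟨n, hn⟩ := QuotientGroup.eq.1 h2
    have e1 : S.inl n = ((1 : E) * (p (x * y)).1)⁻¹ * ((p x).1 * (p y).1) := congrArg Prod.fst hn
    have e2 : (f n)⁻¹ = (Multiplicative.ofAdd ((S.pushout hS f).factorSet (x, y)) *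
        (p (x * y)).2)⁻¹ * ((p x).2 * (p y).2) := congrArg Prod.snd hn
    refine ⟨n, ?_, ?_⟩
    · have hc := Subgroup.mem_center_iff.1 (hS ⟨n, rfl⟩) (p (x * y)).1
      rw [← hc, e1]
      group
    · apply Multiplicative.ofAdd.injective
      change (p x).2 * (p y).2 * f n =
        Multiplicative.ofAdd ((S.pushout hS f).factorSet (x, y)) * (p (x * y)).2
      rw [eq_inv_mul_iff_mul_eq] at e2
      rw [← e2, inv_mul_cancel_right]

/-- If the coboundary of a cochain `c` on `G` agrees with the coboundary of a function `τ` on a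
central extension `E` of `Q` by `ℤ`, and `τ` is translated by `a` under the generator of `ℤ`, then
the transgression of the restriction of `c` is `-a` times the extension class of `E`. -/
theorem smul_extensionClassAlong_eq_neg_transgression {N G Q E : Type} [Group N] [Group G]
    [Group Q] [Group E] (S : GroupExtension N G Q)
    (T : GroupExtension (Multiplicative ℤ) E Q) (hT : T.inl.range ≤ Subgroup.center E)
    (c : G → ℝ) (τ : E → ℝ) (a : ℝ) (hτ1 : τ 1 = 0)
    (hτ : ∀ (n : ℤ) (x : E), τ (T.inl (Multiplicative.ofAdd n) * x) = τ x + a * n)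
    (hc : ∀ g h x y, T.rightHom x = S.rightHom g → T.rightHom y = S.rightHom h →
      c h - c (g * h) + c g = τ y - τ (x * y) + τ x) :
    ∃ hc' : (fun x => c (x 0) : LHS.Cochain (Rep.trivial ℝ G ℝ) 1) ∈
        LHS.Z S.inl.range (Rep.trivial ℝ G ℝ) 2 0 1,
      a • T.extensionClassAlong ℝ hT intToReal =
        -S.transgression ℝ (S.restrictZ ℝ ⟨_, hc'⟩) := by
  -- For a factor in `N` the lift may be taken to be `1`, and `δτ` vanishes when one argument is `1`
  -- because `τ 1 = 0`.
  have hmem : (fun x => c (x 0) : LHS.Cochain (Rep.trivial ℝ G ℝ) 1) ∈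
      LHS.Z S.inl.range (Rep.trivial ℝ G ℝ) 2 0 1 := by
    refine S.mem_Z_zero_one.2 ⟨?_, ?_⟩
    · have h := hc 1 1 1 1 (by simp) (by simp)
      simp only [mul_one, hτ1] at h
      change c 1 = 0
      linarith
    · rintro g h (⟨n, rfl⟩ | ⟨n, rfl⟩)
      · obtain ⟨y, hy⟩ := T.rightHom_surjective (S.rightHom h)
        have h1 := hc (S.inl n) h 1 y (by simp) hy
        rw [one_mul, hτ1] at h1
        change c (S.inl n * h) = c (S.inl n) + c h
        linarith
      · obtain ⟨x, hx⟩ := T.rightHom_surjective (S.rightHom g)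
        have h1 := hc g (S.inl n) x 1 hx (by simp)
        rw [mul_one, hτ1] at h1
        change c (g * S.inl n) = c g + c (S.inl n)
        linarith
  refine ⟨hmem, ?_⟩
  let _ := T.pushoutKernel_normal hT intToReal
  obtain ⟨e, b, he, hfac⟩ := T.exists_lifts_pushout hT intToReal
  rw [S.transgression_restrictZ, extensionClassAlong, extensionClass, ← sub_eq_zero, sub_neg_eq_add]
  rw [← map_smul, ← map_add]
  apply (groupCohomology.H2π_eq_zero_iff _).2
  -- The cobounding function is `τ` on the lifts, corrected by `a` times their components in the new
  -- kernel. Since `e(x)e(y) = n·e(xy)`, `δc` equals `δ(τ∘e) - an`, while the factor set is `δb +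
  -- n`, so in `aχ + δc` the integers cancel.
  refine ⟨fun x => τ (e x) + a * b x, ?_⟩
  ext ⟨x, y⟩
  change (τ (e y) + a * b y) - (τ (e (x * y)) + a * b (x * y)) + (τ (e x) + a * b x) =
    a * (T.pushout hT intToReal).factorSet (x, y) +
      LHS.δ (Rep.trivial ℝ G ℝ) 1 (fun x => c (x 0)) ![S.sec x, S.sec y]
  rw [δ_one_apply]
  obtain ⟨n, hn, hn'⟩ := hfac x y
  have h1 := hc (S.sec x) (S.sec y) (e x) (e y) (by simp [he]) (by simp [he])
  have h2 := hτ (Multiplicative.toAdd n) (e (x * y))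
  rw [ofAdd_toAdd, ← hn] at h2
  have h3 : b x + b y + ((Multiplicative.toAdd n : ℤ) : ℝ) =
    (T.pushout hT intToReal).factorSet (x, y) + b (x * y) := hn'
  rw [h1, h2]
  linear_combination a * h3

end GroupExtension

end

/-! ### The main theorem. -/

theorem mainTheorem2 :
    ∃ (S : GroupExtension SympDiskRel SympDisk DiffCircle)
      (T : GroupExtension (Multiplicative ℤ) DiffCircleCover DiffCircle)
      (hT : T.inl.range ≤ Subgroup.center DiffCircleCover),
      S.inl = SympDiskRel.subtype ∧
      (∀ (g : SympDisk) (z : Circle),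
        circleToDisk ((S.rightHom g).1 z) = g.1 (circleToDisk z)) ∧
      (∀ (n : ℤ) (t : ℝ), (T.inl (Multiplicative.ofAdd n)).1 t = t + 2 * Real.pi * n) ∧
      (∀ (F : DiffCircleCover) (t : ℝ),
        (T.rightHom F).1 (Circle.exp t) = Circle.exp (F.1 t)) ∧
      ∃ Cal : S.invariantHom ℝ ℝ,
        (∀ η : ℂ → ℂ →L[ℝ] ℝ, IsPrimitive η → ∀ h : SympDiskRel, Cal.1 h = calabi η h.1.1) ∧
        (Real.pi ^ 2 : ℝ) • T.extensionClassAlong ℝ hT intToReal = -S.transgression ℝ Cal := by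
  have hT : circleExtension.inl.range ≤ Subgroup.center DiffCircleCover :=
    DiffCircleCover.range_translation_le_center
  obtain ⟨hmem, h⟩ := diskExtension.smul_extensionClassAlong_eq_neg_transgression
    circleExtension hT (fun g => calabi stdPrimitive g.1) DiffCircleCover.quarterIntegral
    (Real.pi ^ 2) DiffCircleCover.quarterIntegral_one
    DiffCircleCover.quarterIntegral_translation_mul
    fun g h x y hx hy => calabi_coboundary_eq (IsBoundaryLift.of_proj_eq hx)
      (IsBoundaryLift.of_proj_eq hy)
  -- `Cal` is the restriction to `G_rel` of the Calabi integral of `(x dy - y dx) / 2`, as an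
  -- element of `Z_2^{0,1}`; this already makes it an invariant homomorphism, and other primitives
  -- give the same values.
  refine ⟨diskExtension, circleExtension, hT, rfl, fun g z => ?_, fun n t => rfl,
    DiffCircleCover.proj_exp, diskExtension.restrictZ ℝ ⟨_, hmem⟩, fun η hη k => ?_, h⟩
  · apply Subtype.ext
    exact (SympDisk.coe_restrict_apply g z).trans (diskFun_of_mem _ (circle_mem_unitDisk z))
  · exact calabi_eq_of_isPrimitive isPrimitive_stdPrimitive hη k
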